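/- **Models.** Let $\Sigma$ be a finite alphabet. An input $w\in\Sigma^*$ of length $n$ is written on a read-only tape between a left and a right end-marker, so that the tape has $n+2$ positions. A head that would move beyond an end-marker stays where it is. A *deterministic $k$-head automaton* has a finite set of states and $k$ two-way heads. In each step, its state and the $k$ symbols scanned determine the new state and, independently for each head, a move by $-1$, $0$ or $+1$. The heads cannot detect each other. A *deterministic bounded counter machine with $k$ counters* has a finite set of states, one two-way head and $k$ counters with values in $\{0,1,\dots,n\}$. In each step, its state, the symbol scanned and the outcome of a zero-test of each counter determine the new state, a move of the head by $-1$, $0$ or $+1$, and for each counter whether it is incremented, decremented or kept. A decrement of $0$ has no effect. For an increment of a counter that holds $n$ (an overflow), fix one of the following conventions: (a) only machines in which no overflow ever happens, on any input, are admitted; (b) the machine blocks, i.e. stays in its current configuration forever; (c) the counter becomes and remains void, and the test of this counter tells the machine so; (d) the counter remains unchanged. All machines start in their initial state with every head on the position next to the left end-marker (the first input symbol, or the right end-marker if $w$ is empty) and every counter equal to $0$. They accept $w$ if they enter a final state at some time, with heads and counters arbitrary. A language $L\subseteq\Sigma^*$ is *strictly bounded* if $L\subseteq a_1^*a_2^*\cdots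 a_m^*$ for some distinct symbols $a_1,\dots,a_m\in\Sigma$. **Theorem.** Let $k\ge 1$ and let $L$ be a strictly bounded language. Under each of the overflow conventions (a)–(d), $L$ is accepted by a deterministic $k$-head automaton if and only if $L$ is accepted by a deterministic bounded counter machine with $k-1$ counters. -/

import Mathlib

/-- What a head can see on the input tape `⊢ w ⊣`: an end-marker or an input letter. -/
inductive TapeSymbol (α : Type*) where
  | leftEnd : TapeSymbol α
  | letter : α → TapeSymbol α
  | rightEnd : TapeSymbol α

/-- The symbol at position `p` of the tape `⊢ w ⊣`. Positions are `0, …, |w| + 1`; position `0`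
holds the left end-marker, position `p` with `1 ≤ p ≤ |w|` the `p`-th letter of `w`, and
position `|w| + 1` the right end-marker. -/
def readTape {α : Type*} (w : List α) : ℕ → TapeSymbol α
  | 0 => TapeSymbol.leftEnd
  | p + 1 =>
    match w[p]? with
    | some a => TapeSymbol.letter a
    | none => TapeSymbol.rightEnd

/-- A movement of a two-way head. -/
inductive HeadMove where
  | left
  | stay
  | right

/-- Effect of a movement on the position of a head, for an input of length `n`. A head never
leaves the `n + 2` positions of the tape: moving left on the left end-marker or right on the
right end-marker has no effect. -/
def HeadMove.apply (n : ℕ) : HeadMove → ℕ → ℕ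
  | .left, p => p - 1
  | .stay, p => p
  | .right, p => min (p + 1) (n + 1)

/-! ### Deterministic automata with `k` two-way heads -/

/-- A deterministic automaton with `k` two-way heads over the input alphabet `α`, with states in
`σ` (finiteness of `σ` is imposed in `AcceptedByHeads`). In each step it reads the `k` scanned
symbols, changes its state and moves the heads independently. -/
structure MultiHeadAutomaton (α : Type*) (k : ℕ) (σ : Type*) where
  start : σ
  final : Set σ
  trans : σ → (Fin k → TapeSymbol α) → σ × (Fin k → HeadMove)

/-- A configuration of an automaton with `k` heads: the state and the head positions. -/
structure MultiHeadConfig (k : ℕ) (σ : Type*) where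
  state : σ
  head : Fin k → ℕ

namespace MultiHeadAutomaton

variable {α σ : Type*} {k : ℕ}

/-- All heads start next to the left end-marker. -/
def init (M : MultiHeadAutomaton α k σ) : MultiHeadConfig k σ where
  state := M.start
  head := fun _ => 1

/-- One step on the input `w`. -/
def step (M : MultiHeadAutomaton α k σ) (w : List α) (c : MultiHeadConfig k σ) :
    MultiHeadConfig k σ where
  state := (M.trans c.state fun i => readTape w (c.head i)).1
  head := fun i => ((M.trans c.state fun i => readTape w (c.head i)).2 i).apply w.length (c.head i)

/-- The configuration after `t` steps on the input `w`. -/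
def run (M : MultiHeadAutomaton α k σ) (w : List α) (t : ℕ) : MultiHeadConfig k σ :=
  (M.step w)^[t] M.init

/-- The accepted language: the inputs on which a final state is entered. -/
def accepts (M : MultiHeadAutomaton α k σ) : Language α :=
  {w | ∃ t, (M.run w t).state ∈ M.final}

end MultiHeadAutomaton

/-- `L` is accepted by a deterministic finite automaton with `k` two-way heads. -/
def AcceptedByHeads {α : Type*} (k : ℕ) (L : Language α) : Prop :=
  ∃ (σ : Type) (_ : Finite σ) (M : MultiHeadAutomaton α k σ), M.accepts = L

/-! ### Deterministic bounded counter machines -/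

/-- The possible conventions for an increment of a bounded counter that already holds the input
length:
* `forbid`: only machines on which this never happens are admitted;
* `block`: the machine blocks (it stays forever in its current configuration);
* `signal`: the counter becomes void, which is signaled to the machine;
* `ignore`: the counter remains unchanged. -/
inductive OverflowPolicy where
  | forbid
  | block
  | signal
  | ignore
  deriving DecidableEq

/-- An operation on a counter. -/
inductive CounterOp where
  | inc
  | dec
  | keep

/-- Effect of an operation on a counter value, ignoring the bound. Decrementing zero has no
effect. -/
def CounterOp.apply : CounterOp → ℕ → ℕ
  | .inc, v => v + 1
  | .dec, v => v - 1
  | .keep, v => v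

/-- The result of the zero-test of a counter. The result `void` can only occur under the policy
`OverflowPolicy.signal`. -/
inductive CounterTest where
  | zero
  | positive
  | void

/-- Testing a counter; the content `none` stands for a void counter. -/
def counterTest : Option ℕ → CounterTest
  | none => .void
  | some 0 => .zero
  | some (_ + 1) => .positive

/-- Whether the operation would make the counter exceed the bound `n`. -/
def counterOverflows (n : ℕ) (op : CounterOp) : Option ℕ → Bool
  | none => false
  | some v => decide (n < op.apply v)

/-- The new content of a counter bounded by `n`. An operation that exceeds the bound makes the
counter void under the policy `signal` and is not carried out under the other policies. A void
counter remains void. -/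
def counterUpdate (pol : OverflowPolicy) (n : ℕ) (op : CounterOp) : Option ℕ → Option ℕ
  | none => none
  | some v =>
    if op.apply v ≤ n then some (op.apply v)
    else if pol = .signal then none
    else some v

/-- A deterministic machine with one two-way input head and `k` counters over the input alphabet
`α`, with states in `σ` (finiteness of `σ` is imposed in `AcceptedByCounters`). In each step it
reads the scanned symbol and tests the counters, changes its state, moves the head and operates on
the counters. -/
structure CounterMachine (α : Type*) (k : ℕ) (σ : Type*) where
  start : σ
  final : Set σ
  trans : σ → TapeSymbol α → (Fin k → CounterTest) → σ × HeadMove × (Fin k → CounterOp)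

/-- A configuration of a machine with `k` counters: the state, the position of the input head and
the contents of the counters. -/
structure CounterConfig (k : ℕ) (σ : Type*) where
  state : σ
  head : ℕ
  counter : Fin k → Option ℕ

namespace CounterMachine

variable {α σ : Type*} {k : ℕ}

/-- The head starts next to the left end-marker, all counters are zero. -/
def init (M : CounterMachine α k σ) : CounterConfig k σ where
  state := M.start
  head := 1
  counter := fun _ => some 0

/-- The new state, head movement and counter operations chosen in the configuration `c`. -/
def action (M : CounterMachine α k σ) (w : List α) (c : CounterConfig k σ) :
    σ × HeadMove × (Fin k → CounterOp) :=
  M.trans c.state (readTape w c.head) fun i => counterTest (c.counter i)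

/-- In the configuration `c` the machine tries to increment a counter beyond the input length. -/
def Overflows (M : CounterMachine α k σ) (w : List α) (c : CounterConfig k σ) : Prop :=
  ∃ i, counterOverflows w.length ((M.action w c).2.2 i) (c.counter i) = true

instance (M : CounterMachine α k σ) (w : List α) (c : CounterConfig k σ) :
    Decidable (M.Overflows w c) := by
  unfold Overflows
  infer_instance

/-- One step on the input `w`, with all counters bounded by the length of `w`. -/
def step (M : CounterMachine α k σ) (pol : OverflowPolicy) (w : List α) (c : CounterConfig k σ) :
    CounterConfig k σ :=
  if pol = .block ∧ M.Overflows w c then c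
  else
    { state := (M.action w c).1
      head := (M.action w c).2.1.apply w.length c.head
      counter := fun i => counterUpdate pol w.length ((M.action w c).2.2 i) (c.counter i) }

/-- The configuration after `t` steps on the input `w`. -/
def run (M : CounterMachine α k σ) (pol : OverflowPolicy) (w : List α) (t : ℕ) :
    CounterConfig k σ :=
  (M.step pol w)^[t] M.init

/-- Under the policy `forbid` only machines whose counters never overflow, on any input, are
admitted; under the other policies all machines are. -/
def Admitted (M : CounterMachine α k σ) (pol : OverflowPolicy) : Prop :=
  pol = .forbid → ∀ w t, ¬ M.Overflows w (M.run pol w t)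

/-- The accepted language: the inputs on which a final state is entered. -/
def accepts (M : CounterMachine α k σ) (pol : OverflowPolicy) : Language α :=
  {w | ∃ t, (M.run pol w t).state ∈ M.final}

end CounterMachine

/-- `L` is accepted by a deterministic machine with one two-way input head and `k` counters bounded
by the input length, under the given overflow policy. -/
def AcceptedByCounters {α : Type*} (pol : OverflowPolicy) (k : ℕ) (L : Language α) : Prop :=
  ∃ (σ : Type) (_ : Finite σ) (M : CounterMachine α k σ), M.Admitted pol ∧ M.accepts pol = L

/-! ### Strictly bounded languages -/

open scoped Computability in
/-- `L ⊆ a₁* a₂* ⋯ aₘ*` for some distinct symbols `a₁, …, aₘ`. -/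
def StrictlyBounded {α : Type*} (L : Language α) : Prop :=
  ∃ l : List α, l.Nodup ∧ L ≤ (l.map fun a => ({[a]} : Language α)∗).prod

/-! ### Simulating counters by heads -/

/-! Counters to heads (`toHeads_accepts`). A counter value `v` is kept as head position `v`: the
left end-marker is zero, and the position `n + 1`, which is no legal value, reveals an overflow.
After each simulated step the automaton looks for counter heads on the right end-marker and applies
the overflow convention in its finite control. This works for every language.

Heads to counters. Let `K + 1` heads be given. In a word of a strictly bounded language every symbol
occupies one interval of the tape, a block, so a head position is determined by the scanned symbol,
kept in the finite memory, and a distance to an end of its block. Storing every distance would take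
`K + 1` counters besides the input head; two observations save one.

First, while all heads stay in their blocks, the scanned symbols are constant and the automaton is
an autonomous finite system. Its states become periodic, so each head drifts in one direction and
never loses more than a constant `N` against it (`exists_noLoss`, `exists_drifts`). If a counter
holds the distance to the block end in the drift direction, a zero-test detects arrival there. The
distance to the other end is needed only up to `N`, because from farther away that end cannot be
crossed before the symbols change (`NearInv.follow`). Hence `K` counters can follow `K` heads, while
the input head itself plays the remaining free one.

Second, the input head has other work to do only when some head crosses a block end. At that moment
the crossing head sits at a known end of a known block and needs no counter. Its counter takes over
the position of the free head, and the input head is available to load, move and re-measure all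
heads in turn. The crossing head becomes the new free head (`exec_cross`, `exec_settle`). Together
these cases simulate every step (`exec_round`).

The simulation never exceeds the bound `n`, so it is independent of the overflow convention. To keep
this true on inputs that are not block words, the machine first checks the block condition
(`exec_prepare`) and idles forever if it fails; such inputs are outside `L`. The machine is
assembled from subroutines whose semantics `Exec` includes the absence of overflows, and `main_loop`
transfers this to infinite runs. -/

/-- Control states of the automaton that stores the value of a counter as the position of a head. -/
inductive HeadSimState (σ : Type*) (k : ℕ) where
  | setup : HeadSimState σ k
  | ready : σ → (Fin k → Bool) → HeadSimState σ k
  | check : σ → σ → (Fin k → Bool) → HeadSimState σ k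
  | stuck : σ → HeadSimState σ k

instance {σ : Type*} {k : ℕ} [Finite σ] : Finite (HeadSimState σ k) := by
  let f : HeadSimState σ k →
      Unit ⊕ (σ × (Fin k → Bool)) ⊕ (σ × σ × (Fin k → Bool)) ⊕ σ
    | .setup => .inl ()
    | .ready q v => .inr (.inl (q, v))
    | .check q q' v => .inr (.inr (.inl (q, q', v)))
    | .stuck q => .inr (.inr (.inr q))
  refine Finite.of_injective f ?_
  rintro (_ | _ | _ | _) (_ | _ | _ | _) h <;> simp_all [f]

/-- The head movement that carries out a counter operation. -/
def CounterOp.toMove : CounterOp → HeadMove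
  | .inc => .right
  | .dec => .left
  | .keep => .stay

/-- The zero-test of a counter that is stored as a head position, given its void flag. -/
def symbolTest {α : Type*} (void : Bool) : TapeSymbol α → CounterTest
  | .leftEnd => if void then .void else .zero
  | _ => if void then .void else .positive

/-- Whether the scanned symbol is the right end-marker. -/
def TapeSymbol.isRight {α : Type*} : TapeSymbol α → Bool
  | .rightEnd => true
  | _ => false

namespace CounterMachine

variable {α σ : Type*} {k : ℕ}

/-- The automaton with `k + 1` heads that simulates a machine with `k` counters. -/
def toHeads (M : CounterMachine α k σ) (pol : OverflowPolicy) :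
    MultiHeadAutomaton α (k + 1) (HeadSimState σ k) where
  start := .setup
  final := {s | ∃ q ∈ M.final, (∃ v, s = .ready q v) ∨ s = .stuck q}
  trans s y :=
    match s with
    | .setup => (.ready M.start fun _ => false, Fin.cons .stay fun _ => .left)
    | .ready q v =>
      let r := M.trans q (y 0) fun i => symbolTest (v i) (y i.succ)
      (.check q r.1 v, Fin.cons r.2.1 fun i => if v i then .stay else (r.2.2 i).toMove)
    | .check q q' v =>
      if pol = .block ∧ ∃ i, v i = false ∧ (y (Fin.succ i)).isRight then
        (.stuck q, fun _ => .stay)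
      else if pol = .signal then
        (.ready q' fun i => v i || (y i.succ).isRight, fun _ => .stay)
      else
        (.ready q' v, Fin.cons .stay fun i =>
          if v i = false ∧ (y (Fin.succ i)).isRight then .left else .stay)
    | .stuck q => (.stuck q, fun _ => .stay)

theorem readTape_isRight (w : List α) (p : ℕ) : (readTape w p).isRight = decide (w.length < p) := by
  rcases p with _ | p
  · simp [readTape, TapeSymbol.isRight]
  · rcases lt_or_ge p w.length with h | h
    · simp [readTape, TapeSymbol.isRight, h]
    · simp [readTape, TapeSymbol.isRight, h]

theorem symbolTest_readTape (w : List α) (p : ℕ) :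
    symbolTest false (readTape w p) = counterTest (some p) := by
  rcases p with _ | p
  · simp [readTape, symbolTest, counterTest]
  · rcases lt_or_ge p w.length with h | h <;>
    simp [readTape, symbolTest, counterTest, h]

theorem symbolTest_true (y : TapeSymbol α) : symbolTest true y = .void := by
  cases y <;> simp [symbolTest]

/-- The configuration `d` of the simulating automaton represents the configuration `c`, where `v`
tells which counters are void. -/
structure HeadSim (w : List α) (c : CounterConfig k σ)
    (d : MultiHeadConfig (k + 1) (HeadSimState σ k)) (v : Fin k → Bool) : Prop where
  state : d.state = .ready c.state v
  head : d.head 0 = c.head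
  counter : ∀ i, (v i = true ∧ c.counter i = none) ∨
    (v i = false ∧ c.counter i = some (d.head i.succ) ∧ d.head i.succ ≤ w.length)

/-- Two steps are needed because an overflow is seen only after the heads have moved: the
intermediate `check` state still knows the old state, to which a blocking machine must return. -/
theorem HeadSim.step {M : CounterMachine α k σ} {pol : OverflowPolicy} {w : List α}
    {c : CounterConfig k σ} {d : MultiHeadConfig (k + 1) (HeadSimState σ k)} {v : Fin k → Bool}
    (h : HeadSim w c d v) :
    ((M.toHeads pol).step w d).state ∉ (M.toHeads pol).final ∧
    ((∃ v', HeadSim w (M.step pol w c) ((M.toHeads pol).step w ((M.toHeads pol).step w d)) v') ∨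
      (((M.toHeads pol).step w ((M.toHeads pol).step w d)).state = .stuck c.state ∧
        M.step pol w c = c)) := by
  obtain ⟨hs, hh, hc⟩ := h
  have hact : M.trans c.state (readTape w (d.head 0))
      (fun i => symbolTest (v i) (readTape w (d.head i.succ))) = M.action w c := by
    rw [action, hh]
    congr 1
    funext i
    rcases hc i with ⟨h1, h2⟩ | ⟨h1, h2, -⟩
    · rw [h1, h2, symbolTest_true, counterTest]
    · rw [h1, h2, symbolTest_readTape]
  set d₁ := (M.toHeads pol).step w d with hd₁
  have hs₁ : d₁.state = .check c.state (M.action w c).1 v := by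
    rw [hd₁, MultiHeadAutomaton.step, hs]
    simp [toHeads, hact]
  have hz₁ : d₁.head 0 = (M.action w c).2.1.apply w.length c.head := by
    rw [hd₁, MultiHeadAutomaton.step, hs]
    simp [toHeads, hact]
    rw [hh]
  have hc₁ : ∀ i, d₁.head (Fin.succ i) = (if v i then HeadMove.stay else
      ((M.action w c).2.2 i).toMove).apply w.length (d.head i.succ) := by
    intro i
    rw [hd₁, MultiHeadAutomaton.step, hs]
    simp [toHeads, hact]
  have hval : ∀ i, v i = false → c.counter i = some (d.head i.succ) ∧ d.head i.succ ≤ w.length ∧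
      d₁.head i.succ = ((M.action w c).2.2 i).apply (d.head i.succ) := by
    intro i hi
    rcases hc i with ⟨h1, h2⟩ | ⟨h1, h2, h3⟩
    · simp [hi] at h1
    · refine ⟨h2, h3, ?_⟩
      rw [hc₁ i, hi]
      cases (M.action w c).2.2 i <;> simp [CounterOp.toMove, HeadMove.apply, CounterOp.apply, h3]
  have hnone : ∀ i, v i = true → c.counter i = none := by
    intro i hi
    rcases hc i with ⟨h1, h2⟩ | ⟨h1, h2, h3⟩
    · exact h2
    · simp [hi] at h1
  -- A stored value is at most `n`, so the move never hits the end-marker with an effect cut off,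
  -- and standing on the right end-marker means exactly the value `n + 1`.
  have hover : M.Overflows w c ↔ ∃ i, v i = false ∧ (readTape w (d₁.head i.succ)).isRight := by
    refine exists_congr fun i => ?_
    rw [readTape_isRight]
    cases hi : v i
    · obtain ⟨h1, h2, h3⟩ := hval i hi
      rw [h1, h3]
      simp [counterOverflows]
    · simp [hnone i hi, counterOverflows]
  refine ⟨?_, ?_⟩
  · rw [hs₁]
    simp [toHeads]
  by_cases hb : pol = .block ∧ M.Overflows w c
  · refine Or.inr ⟨?_, by rw [CounterMachine.step, if_pos hb]⟩
    rw [MultiHeadAutomaton.step, hs₁]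
    simp only [toHeads]
    rw [if_pos ⟨hb.1, hover.1 hb.2⟩]
  left
  have hb' : ¬ (pol = .block ∧ ∃ i, v i = false ∧ (readTape w (d₁.head i.succ)).isRight) := by
    rwa [← hover]
  by_cases hp : pol = .signal
  · refine ⟨fun i => v i || (readTape w (d₁.head i.succ)).isRight, ?_, ?_, ?_⟩
    · rw [MultiHeadAutomaton.step, hs₁, CounterMachine.step, if_neg hb]
      simp only [toHeads]
      rw [if_neg hb', if_pos hp]
    · rw [MultiHeadAutomaton.step, hs₁, CounterMachine.step, if_neg hb]
      simp only [toHeads]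
      rw [if_neg hb', if_pos hp]
      simp [HeadMove.apply, hz₁]
    · intro i
      rw [MultiHeadAutomaton.step, hs₁, CounterMachine.step, if_neg hb]
      simp only [toHeads]
      rw [if_neg hb', if_pos hp, readTape_isRight]
      cases hi : v i
      · obtain ⟨h1, h2, h3⟩ := hval i hi
        rw [h1, h3]
        by_cases hle : ((M.action w c).2.2 i).apply (d.head i.succ) ≤ w.length
        · right
          simp [counterUpdate, HeadMove.apply, hle]
        · left
          simp [counterUpdate, hle, hp]
          omega
      · simp [hnone i hi, counterUpdate]
  · refine ⟨v, ?_, ?_, ?_⟩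
    · rw [MultiHeadAutomaton.step, hs₁, CounterMachine.step, if_neg hb]
      simp only [toHeads]
      rw [if_neg hb', if_neg hp]
    · rw [MultiHeadAutomaton.step, hs₁, CounterMachine.step, if_neg hb]
      simp only [toHeads]
      rw [if_neg hb', if_neg hp]
      simp [HeadMove.apply, hz₁]
    · intro i
      rw [MultiHeadAutomaton.step, hs₁, CounterMachine.step, if_neg hb]
      simp only [toHeads]
      rw [if_neg hb', if_neg hp]
      cases hi : v i
      · obtain ⟨h1, h2, h3⟩ := hval i hi
        right
        simp only [Fin.cons_succ, readTape_isRight]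
        rw [h1, h3, hi]
        by_cases hle : ((M.action w c).2.2 i).apply (d.head i.succ) ≤ w.length
        · simp [counterUpdate, hle, HeadMove.apply, Nat.not_lt.2 hle]
        -- Only an increment can exceed the bound, so the corrective move to the left restores the
        -- old value.
        · have : ((M.action w c).2.2 i).apply (d.head i.succ) = d.head i.succ + 1 := by
            revert hle
            cases (M.action w c).2.2 i <;> simp [CounterOp.apply] <;> omega
          rw [this] at hle ⊢
          have hlt : w.length < d.head i.succ + 1 := by omega
          simp [counterUpdate, hle, hp, this, hlt, HeadMove.apply, h2]
      · simp [hnone i hi, counterUpdate]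

/-- The offset by one is the setup step, which brings the counter heads from position `1` to `0`.
Final states are excluded at even times, except after blocking, so that no acceptance is added
between two simulated steps. -/
theorem toHeads_run (M : CounterMachine α k σ) (pol : OverflowPolicy) (w : List α) (t : ℕ) :
    ((M.toHeads pol).run w (2 * t)).state ∉ (M.toHeads pol).final ∧
    ((∃ v, HeadSim w (M.run pol w t) ((M.toHeads pol).run w (2 * t + 1)) v) ∨
      (((M.toHeads pol).run w (2 * t + 1)).state = .stuck (M.run pol w t).state ∧
        M.step pol w (M.run pol w t) = M.run pol w t)) ∨
    (((M.toHeads pol).run w (2 * t)).state = .stuck (M.run pol w t).state ∧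
     ((M.toHeads pol).run w (2 * t + 1)).state = .stuck (M.run pol w t).state ∧
        M.step pol w (M.run pol w t) = M.run pol w t) := by
  induction t with
  | zero =>
    refine Or.inl ⟨by simp [MultiHeadAutomaton.run, MultiHeadAutomaton.init, toHeads],
      Or.inl ⟨fun _ => false, ?_, ?_, ?_⟩⟩
    · simp [MultiHeadAutomaton.run, MultiHeadAutomaton.init, MultiHeadAutomaton.step, toHeads,
        CounterMachine.run, CounterMachine.init]
    · simp [MultiHeadAutomaton.run, MultiHeadAutomaton.init, MultiHeadAutomaton.step, toHeads,
        CounterMachine.run, CounterMachine.init, HeadMove.apply]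
    · simp [MultiHeadAutomaton.run, MultiHeadAutomaton.init, MultiHeadAutomaton.step, toHeads,
        CounterMachine.run, CounterMachine.init, HeadMove.apply]
  | succ t ih =>
    have e1 : (M.toHeads pol).run w (2 * (t + 1)) =
        (M.toHeads pol).step w ((M.toHeads pol).run w (2 * t + 1)) := by
      exact Function.iterate_succ_apply' _ _ _
    have e2 : (M.toHeads pol).run w (2 * (t + 1) + 1) =
        (M.toHeads pol).step w ((M.toHeads pol).step w ((M.toHeads pol).run w (2 * t + 1))) := by
      rw [← e1]
      exact Function.iterate_succ_apply' _ _ _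
    have e3 : M.run pol w (t + 1) = M.step pol w (M.run pol w t) := by
      exact Function.iterate_succ_apply' _ _ _
    have hst : ∀ (d : MultiHeadConfig (k + 1) (HeadSimState σ k)) (q : σ), d.state = .stuck q →
        ((M.toHeads pol).step w d).state = .stuck q := by
      intro d q hd
      rw [MultiHeadAutomaton.step, hd]
      simp [toHeads]
    have key : ((M.toHeads pol).run w (2 * t + 1)).state = .stuck (M.run pol w t).state →
        M.step pol w (M.run pol w t) = M.run pol w t →
        ((M.toHeads pol).run w (2 * (t + 1))).state = .stuck (M.run pol w (t + 1)).state ∧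
        ((M.toHeads pol).run w (2 * (t + 1) + 1)).state = .stuck (M.run pol w (t + 1)).state ∧
        M.step pol w (M.run pol w (t + 1)) = M.run pol w (t + 1) := by
      intro h1 h2
      rw [e1, e2, e3, h2]
      exact ⟨hst _ _ h1, hst _ _ (hst _ _ h1), h2⟩
    rcases ih with ⟨-, ⟨v, hv⟩ | ⟨h1, h2⟩⟩ | ⟨-, h1, h2⟩
    · obtain ⟨h1, h2⟩ := hv.step (M := M) (pol := pol)
      refine Or.inl ⟨by rwa [e1], ?_⟩
      rw [e2, e3]
      rcases h2 with h2 | ⟨h2, h3⟩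
      · exact Or.inl h2
      · exact Or.inr ⟨by rw [h3]; exact h2, by rw [h3]; exact h3⟩
    · exact Or.inr (key h1 h2)
    · exact Or.inr (key h1 h2)

theorem toHeads_accepts (M : CounterMachine α k σ) (pol : OverflowPolicy) :
    (M.toHeads pol).accepts = M.accepts pol := by
  have hstuck : ∀ q, HeadSimState.stuck q ∈ (M.toHeads pol).final ↔ q ∈ M.final := by
    intro q; simp [toHeads]
  have hready : ∀ q v, HeadSimState.ready q v ∈ (M.toHeads pol).final ↔ q ∈ M.final := by
    intro q v; simp [toHeads]
  ext w
  constructor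
  · rintro ⟨T, hT⟩
    rcases Nat.even_or_odd' T with ⟨t, rfl | rfl⟩
    · rcases toHeads_run M pol w t with ⟨h, -⟩ | ⟨h, -⟩
      · exact absurd hT h
      · rw [h, hstuck] at hT
        exact ⟨t, hT⟩
    · refine ⟨t, ?_⟩
      rcases toHeads_run M pol w t with ⟨-, ⟨v, hv⟩ | ⟨h, -⟩⟩ | ⟨-, h, -⟩
      · rwa [hv.state, hready] at hT
      · rwa [h, hstuck] at hT
      · rwa [h, hstuck] at hT
  · rintro ⟨t, ht⟩
    refine ⟨2 * t + 1, ?_⟩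
    rcases toHeads_run M pol w t with ⟨-, ⟨v, hv⟩ | ⟨h, -⟩⟩ | ⟨-, h, -⟩
    · rwa [hv.state, hready]
    · rwa [h, hstuck]
    · rwa [h, hstuck]

end CounterMachine

theorem AcceptedByCounters.acceptedByHeads {α : Type*} {pol : OverflowPolicy} {k : ℕ}
    {L : Language α} (h : AcceptedByCounters pol k L) : AcceptedByHeads (k + 1) L := by
  obtain ⟨σ, hσ, M, -, rfl⟩ := h
  exact ⟨HeadSimState σ k, inferInstance, M.toHeads pol, M.toHeads_accepts pol⟩

/-! ### Subroutines of counter machines -/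

/-- A configuration of a subroutine: control, head position and counter values. -/
abbrev Conf (K : ℕ) (X : Type*) := X × ℕ × (Fin K → ℕ)

/-- A subroutine for a counter machine, operating on a finite memory `S`. It is entered with some
memory content, runs under its own finite control, and is left with some memory content. -/
structure Gadget.{v, u} (α : Type v) (K : ℕ) (S : Type u) where
  Control : Type u
  finite_control : Finite Control
  entry : S → Control
  trans : Control → TapeSymbol α → (Fin K → Bool) → (Control ⊕ S) × HeadMove × (Fin K → CounterOp)

namespace Gadget

universe u

variable {α : Type*} {S : Type u} {K : ℕ}

/-- The result of a step, ignoring the bound on the counters. -/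
def next (G : Gadget α K S) (w : List α) (q : G.Control) (h : ℕ) (c : Fin K → ℕ) :
    Conf K (G.Control ⊕ S) :=
  let r := G.trans q (readTape w h) fun i => decide (c i = 0)
  (r.1, r.2.1.apply w.length h, fun i => (r.2.2 i).apply (c i))

/-- One step that does not violate the bound on the counters. -/
inductive Step (G : Gadget α K S) (w : List α) :
    Conf K (G.Control ⊕ S) → Conf K (G.Control ⊕ S) → Prop
  | intro (q : G.Control) (h : ℕ) (c : Fin K → ℕ) (hc : ∀ i, (G.next w q h c).2.2 i ≤ w.length) :
    Step G w (.inl q, h, c) (G.next w q h c)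

theorem Step.of_eq {G : Gadget α K S} {w : List α} {q : G.Control} {h : ℕ} {c : Fin K → ℕ}
    {b : Conf K (G.Control ⊕ S)} (hb : G.next w q h c = b) (hc : ∀ i, b.2.2 i ≤ w.length) :
    G.Step w (.inl q, h, c) b := by
  subst hb
  exact .intro q h c hc

/-- The subroutine, entered at `a`, is left at `b`, and no counter overflows. -/
def Exec (G : Gadget α K S) (w : List α) (a b : Conf K S) : Prop :=
  Relation.ReflTransGen (G.Step w) (.inl (G.entry a.1), a.2) (.inr b.1, b.2)

/-- A single step. -/
def act [Finite S] (f : S → TapeSymbol α → (Fin K → Bool) → S × HeadMove × (Fin K → CounterOp)) :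
    Gadget α K S where
  Control := S
  finite_control := inferInstance
  entry := id
  trans s y t := (.inr (f s y t).1, (f s y t).2)

theorem exec_act [Finite S] {w : List α}
    {f : S → TapeSymbol α → (Fin K → Bool) → S × HeadMove × (Fin K → CounterOp)}
    {s s' : S} {h : ℕ} {c c' : Fin K → ℕ} {m : HeadMove} {ops : Fin K → CounterOp}
    (hf : f s (readTape w h) (fun i => decide (c i = 0)) = (s', m, ops))
    (hc : ∀ i, (ops i).apply (c i) = c' i) (hle : ∀ i, c' i ≤ w.length) :
    (act f).Exec w (s, h, c) (s', m.apply w.length h, c') := by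
  refine .single (Step.of_eq ?_ hle)
  simp only [next, act, id, hf]
  simp [hc]

theorem exec_keep [Finite S] {w : List α}
    {f : S → TapeSymbol α → (Fin K → Bool) → S × HeadMove × (Fin K → CounterOp)}
    {s : S} {h : ℕ} {c : Fin K → ℕ} (s' : S) (m : HeadMove)
    (hf : f s (readTape w h) (fun i => decide (c i = 0)) = (s', m, fun _ => .keep))
    (hc : ∀ i, c i ≤ w.length) :
    (act f).Exec w (s, h, c) (s', m.apply w.length h, c) :=
  exec_act hf (fun _ => rfl) hc

theorem exec_keep_stay [Finite S] {w : List α}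
    {f : S → TapeSymbol α → (Fin K → Bool) → S × HeadMove × (Fin K → CounterOp)}
    {s : S} {h : ℕ} {c : Fin K → ℕ} (s' : S)
    (hf : f s (readTape w h) (fun i => decide (c i = 0)) = (s', .stay, fun _ => .keep))
    (hc : ∀ i, c i ≤ w.length) :
    (act f).Exec w (s, h, c) (s', h, c) :=
  exec_keep s' .stay hf hc

/-- Sequential composition. -/
def seq (G H : Gadget α K S) : Gadget α K S where
  Control := G.Control ⊕ H.Control
  finite_control := by
    have := G.finite_control
    have := H.finite_control
    infer_instance
  entry s := .inl (G.entry s)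
  trans
    | .inl q, y, t =>
      ((G.trans q y t).1.elim (fun r => .inl (.inl r)) (fun s => .inl (.inr (H.entry s))),
        (G.trans q y t).2)
    | .inr q, y, t => ((H.trans q y t).1.map .inr id, (H.trans q y t).2)

/-- Leaving `G` is identified with entering `H`; under this map each step of `G` is literally a step
of the composition. -/
theorem seq_lift_left {G H : Gadget α K S} {w : List α} {a b : Conf K (G.Control ⊕ S)}
    (h : Relation.ReflTransGen (G.Step w) a b) :
    Relation.ReflTransGen ((G.seq H).Step w)
      (a.1.elim (fun r => .inl (.inl r)) (fun s => .inl (.inr (H.entry s))), a.2)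
      (b.1.elim (fun r => .inl (.inl r)) (fun s => .inl (.inr (H.entry s))), b.2) := by
  refine Relation.ReflTransGen.lift (p := (G.seq H).Step w)
    (fun x : Conf K (G.Control ⊕ S) =>
    ((x.1.elim (fun r => .inl (.inl r)) (fun s => .inl (.inr (H.entry s))), x.2) :
      Conf K ((G.seq H).Control ⊕ S))) ?_ _ _ h
  rintro _ _ ⟨q, h, c, hc⟩
  exact Step.of_eq rfl hc

theorem seq_lift_right {G H : Gadget α K S} {w : List α} {a b : Conf K (H.Control ⊕ S)}
    (h : Relation.ReflTransGen (H.Step w) a b) :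
    Relation.ReflTransGen ((G.seq H).Step w) (a.1.map .inr id, a.2) (b.1.map .inr id, b.2) := by
  refine Relation.ReflTransGen.lift (p := (G.seq H).Step w)
    (fun x : Conf K (H.Control ⊕ S) =>
    ((x.1.map .inr id, x.2) : Conf K ((G.seq H).Control ⊕ S))) ?_ _ _ h
  rintro _ _ ⟨q, h, c, hc⟩
  exact Step.of_eq rfl hc

theorem Exec.seq {G H : Gadget α K S} {w : List α} {a b c : Conf K S}
    (h₁ : G.Exec w a b) (h₂ : H.Exec w b c) : (G.seq H).Exec w a c :=
  (seq_lift_left h₁).trans (seq_lift_right h₂)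

/-- Branching on the memory. -/
def cond (b : S → Bool) (G H : Gadget α K S) : Gadget α K S where
  Control := G.Control ⊕ H.Control
  finite_control := by
    have := G.finite_control
    have := H.finite_control
    infer_instance
  entry s := if b s then .inl (G.entry s) else .inr (H.entry s)
  trans
    | .inl q, y, t => ((G.trans q y t).1.map .inl id, (G.trans q y t).2)
    | .inr q, y, t => ((H.trans q y t).1.map .inr id, (H.trans q y t).2)

theorem Exec.cond_true {b : S → Bool} {G H : Gadget α K S} {w : List α} {x y : Conf K S}
    (hb : b x.1 = true) (h : G.Exec w x y) : (cond b G H).Exec w x y := by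
  have := Relation.ReflTransGen.lift (p := (cond b G H).Step w)
    (fun x : Conf K (G.Control ⊕ S) =>
    ((x.1.map .inl id, x.2) : Conf K ((cond b G H).Control ⊕ S))) (by
    rintro _ _ ⟨q, h, c, hc⟩
    exact Step.of_eq rfl hc) _ _ h
  have he : (cond b G H).entry x.1 = .inl (G.entry x.1) := by simp [cond, hb]
  rw [Exec, he]
  exact this

theorem Exec.cond_false {b : S → Bool} {G H : Gadget α K S} {w : List α} {x y : Conf K S}
    (hb : b x.1 = false) (h : H.Exec w x y) : (cond b G H).Exec w x y := by
  have := Relation.ReflTransGen.lift (p := (cond b G H).Step w)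
    (fun x : Conf K (H.Control ⊕ S) =>
    ((x.1.map .inr id, x.2) : Conf K ((cond b G H).Control ⊕ S))) (by
    rintro _ _ ⟨q, h, c, hc⟩
    exact Step.of_eq rfl hc) _ _ h
  have he : (cond b G H).entry x.1 = .inr (H.entry x.1) := by simp [cond, hb]
  rw [Exec, he]
  exact this

/-- Repeating a subroutine as long as a test succeeds. -/
def loop [Finite S] (b : S → TapeSymbol α → (Fin K → Bool) → Bool) (G : Gadget α K S) :
    Gadget α K S where
  Control := G.Control ⊕ S
  finite_control := by
    have := G.finite_control
    infer_instance
  entry := .inr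
  trans
    | .inl q, y, t => (.inl (G.trans q y t).1, (G.trans q y t).2)
    | .inr s, y, t => (if b s y t then .inl (.inl (G.entry s)) else .inr s, .stay, fun _ => .keep)

theorem exec_loop_false [Finite S] {b : S → TapeSymbol α → (Fin K → Bool) → Bool}
    {G : Gadget α K S} {w : List α} {x : Conf K S} (hx : ∀ i, x.2.2 i ≤ w.length)
    (hb : b x.1 (readTape w x.2.1) (fun i => decide (x.2.2 i = 0)) = false) :
    (loop b G).Exec w x x := by
  refine .single (Step.of_eq ?_ hx)
  simp only [next, loop, hb]
  simp [HeadMove.apply, CounterOp.apply]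

/-- Stated with at least one step, so that infinitely many rounds give an infinite run. -/
theorem transGen_loop [Finite S] {b : S → TapeSymbol α → (Fin K → Bool) → Bool}
    {G : Gadget α K S} {w : List α} {x y : Conf K S} (hx : ∀ i, x.2.2 i ≤ w.length)
    (hb : b x.1 (readTape w x.2.1) (fun i => decide (x.2.2 i = 0)) = true)
    (h : G.Exec w x y) :
    Relation.TransGen ((loop b G).Step w) (.inl (.inr x.1), x.2) (.inl (.inr y.1), y.2) := by
  have h₁ : (loop b G).Step w (.inl (.inr x.1), x.2) (.inl (.inl (G.entry x.1)), x.2) := by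
    refine Step.of_eq ?_ hx
    simp only [next, loop, hb]
    simp [HeadMove.apply, CounterOp.apply]
  refine Relation.TransGen.head' h₁ ?_
  refine Relation.ReflTransGen.lift (p := (loop b G).Step w)
    (fun x : Conf K (G.Control ⊕ S) =>
    ((.inl x.1, x.2) : Conf K ((loop b G).Control ⊕ S))) ?_ _ _ h
  rintro _ _ ⟨q, h, c, hc⟩
  exact Step.of_eq rfl hc

theorem exec_loop_true [Finite S] {b : S → TapeSymbol α → (Fin K → Bool) → Bool}
    {G : Gadget α K S} {w : List α} {x y z : Conf K S} (hx : ∀ i, x.2.2 i ≤ w.length)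
    (hb : b x.1 (readTape w x.2.1) (fun i => decide (x.2.2 i = 0)) = true)
    (h : G.Exec w x y) (h' : (loop b G).Exec w y z) : (loop b G).Exec w x z :=
  (transGen_loop hx hb h).to_reflTransGen.trans h'

/-- Running a family of subroutines one after the other. -/
def forEach [Finite S] {ι : Type*} (g : ι → Gadget α K S) : List ι → Gadget α K S
  | [] => act fun s _ _ => (s, .stay, fun _ => .keep)
  | i :: l => (g i).seq (forEach g l)

theorem exec_skip [Finite S] {w : List α} {x : Conf K S} (hx : ∀ i, x.2.2 i ≤ w.length) :
    (act (α := α) fun s _ _ => (s, .stay, fun _ => .keep)).Exec w x x :=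
  exec_act (m := .stay) rfl (fun _ => rfl) hx

/-- `J D` is an invariant indexed by the set `D` of the items already treated. -/
theorem exec_forEach [Finite S] {ι : Type*} {g : ι → Gadget α K S} {w : List α}
    (J : Set ι → Conf K S → Prop) (hJ : ∀ D x, J D x → ∀ i, x.2.2 i ≤ w.length)
    (hg : ∀ D x i, i ∉ D → J D x → ∃ y, (g i).Exec w x y ∧ J (insert i D) y)
    (l : List ι) (hl : l.Nodup) (D : Set ι) (hD : ∀ i ∈ l, i ∉ D) (x : Conf K S) (hx : J D x) :
    ∃ y, (forEach g l).Exec w x y ∧ J (D ∪ {i | i ∈ l}) y := by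
  induction l generalizing D x with
  | nil => exact ⟨x, exec_skip (hJ _ _ hx), by simpa using hx⟩
  | cons i l ih =>
    rw [List.nodup_cons] at hl
    obtain ⟨y, h₁, h₂⟩ := hg D x i (hD i (by simp)) hx
    obtain ⟨z, h₃, h₄⟩ := ih hl.2 (insert i D) (by
      intro j hj hjD
      rcases hjD with rfl | hjD
      · exact hl.1 hj
      · exact hD j (by simp [hj]) hjD) y h₂
    refine ⟨z, h₁.seq h₃, ?_⟩
    convert h₄ using 1
    ext j
    simp only [Set.mem_union, Set.mem_ofPred_eq, List.mem_cons, Set.mem_insert_iff]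
    tauto

/-! ### From subroutines to machines -/

/-- The counter machine that runs a subroutine and accepts when it is left. -/
def toMachine (G : Gadget α K S) (s₀ : S) : CounterMachine α K (G.Control ⊕ S) where
  start := .inl (G.entry s₀)
  final := Set.range Sum.inr
  trans
    | .inl q, y, t => G.trans q y fun i => match t i with
      | .zero => true
      | _ => false
    | .inr s, _, _ => (.inr s, .stay, fun _ => .keep)

/-- The configuration of the machine that corresponds to a configuration of the subroutine. -/
def embed {X : Type*} (a : Conf K X) : CounterConfig K X where
  state := a.1
  head := a.2.1
  counter i := some (a.2.2 i)

theorem counterTest_eq (v : ℕ) : (match counterTest (some v) with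
      | .zero => true
      | _ => false) = decide (v = 0) := by
  cases v <;> simp [counterTest]

/-- Subroutine steps respect the counter bound, which is why all overflow conventions act alike on
them. -/
theorem Step.embed {G : Gadget α K S} {s₀ : S} {w : List α} {a b : Conf K (G.Control ⊕ S)}
    (h : G.Step w a b) (pol : OverflowPolicy) :
    ¬ (G.toMachine s₀).Overflows w (embed a) ∧
      (G.toMachine s₀).step pol w (Gadget.embed a) = Gadget.embed b := by
  obtain ⟨q, h, c, hc⟩ := h
  have hact : (G.toMachine s₀).action w (Gadget.embed (.inl q, h, c)) =
      G.trans q (readTape w h) fun i => decide (c i = 0) := by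
    simp only [CounterMachine.action, toMachine, Gadget.embed, counterTest_eq]
  have hno : ¬ (G.toMachine s₀).Overflows w (Gadget.embed (.inl q, h, c)) := by
    rintro ⟨i, hi⟩
    rw [hact] at hi
    have := hc i
    simp only [counterOverflows, Gadget.embed, decide_eq_true_eq] at hi
    simp only [next] at this
    omega
  refine ⟨hno, ?_⟩
  rw [CounterMachine.step, if_neg (fun h => hno h.2), hact]
  simp only [Gadget.embed, next, CounterConfig.mk.injEq, true_and]
  funext i
  have := hc i
  simp only [next] at this
  simp [counterUpdate, this]

theorem exec_run {G : Gadget α K S} {s₀ : S} {w : List α} {a : Conf K (G.Control ⊕ S)}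
    {b : Conf K S} (h : Relation.ReflTransGen (G.Step w) a (.inr b.1, b.2))
    (hb : ∀ i, b.2.2 i ≤ w.length) (pol : OverflowPolicy) :
    (∀ t, ¬ (G.toMachine s₀).Overflows w (((G.toMachine s₀).step pol w)^[t] (embed a))) ∧
      ∃ t, (((G.toMachine s₀).step pol w)^[t] (embed a)).state ∈ (G.toMachine s₀).final := by
  induction h using Relation.ReflTransGen.head_induction_on with
  | refl =>
    have hact : (G.toMachine s₀).action w (embed (.inr b.1, b.2)) =
        (.inr b.1, .stay, fun _ => .keep) := rfl
    have hno : ¬ (G.toMachine s₀).Overflows w (embed (.inr b.1, b.2)) := by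
      rintro ⟨i, hi⟩
      rw [hact] at hi
      exact absurd (hb i) (Nat.not_le.2 (of_decide_eq_true hi))
    have hst : (G.toMachine s₀).step pol w (embed (.inr b.1, b.2)) = embed (.inr b.1, b.2) := by
      rw [CounterMachine.step, if_neg (fun h => hno h.2), hact]
      simp [embed, HeadMove.apply, counterUpdate, CounterOp.apply, hb]
    refine ⟨fun t => ?_, 0, b.1, rfl⟩
    rw [Function.iterate_fixed hst]
    exact hno
  | head h₁ _ ih =>
    obtain ⟨hno, hst⟩ := h₁.embed (s₀ := s₀) pol
    refine ⟨fun t => ?_, ?_⟩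
    · cases t with
      | zero => exact hno
      | succ t =>
        rw [Function.iterate_succ_apply, hst]
        exact ih.1 t
    · obtain ⟨t, ht⟩ := ih.2
      exact ⟨t + 1, by rwa [Function.iterate_succ_apply, hst]⟩

/-- Nontermination: the machine is deterministic, so a set of checkpoints, each leading to another
in at least one step, traps the run. Every configuration on the way still has a subroutine step
ahead, hence neither overflows nor has been left. -/
theorem chain_run {G : Gadget α K S} {s₀ : S} {w : List α} {Z : Set (Conf K (G.Control ⊕ S))}
    (hZ : ∀ z ∈ Z, ∃ z' ∈ Z, Relation.TransGen (G.Step w) z z') (pol : OverflowPolicy) (t : ℕ)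
    (a : Conf K (G.Control ⊕ S)) (ha : ∃ z ∈ Z, Relation.ReflTransGen (G.Step w) a z) :
    ¬ (G.toMachine s₀).Overflows w (((G.toMachine s₀).step pol w)^[t] (embed a)) ∧
      (((G.toMachine s₀).step pol w)^[t] (embed a)).state ∉ (G.toMachine s₀).final := by
  obtain ⟨z, hz, haz⟩ := ha
  obtain ⟨z', hz', hzz'⟩ := hZ z hz
  obtain ⟨y, h₁, h₂⟩ := Relation.TransGen.head'_iff.1 (hzz'.trans_right haz)
  obtain ⟨hno, hst⟩ := h₁.embed (s₀ := s₀) pol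
  induction t generalizing a z z' y with
  | zero =>
    refine ⟨hno, ?_⟩
    obtain ⟨q, h, c, hc⟩ := h₁
    simp [embed, toMachine]
  | succ t ih =>
    rw [Function.iterate_succ_apply, hst]
    obtain ⟨z'', hz'', hzz''⟩ := hZ z' hz'
    obtain ⟨y', h₃, h₄⟩ := Relation.TransGen.head'_iff.1 (hzz''.trans_right h₂)
    obtain ⟨hno', hst'⟩ := h₃.embed (s₀ := s₀) pol
    exact ih y z' hz' h₂ z'' hz'' hzz'' y' h₃ h₄ hno' hst'

/-- If every round of the main loop simulates one step of `f`, then the machine accepts when the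
simulated orbit meets `acc`. -/
theorem main_loop [Finite S] {G₀ G : Gadget α K S} {b : S → Bool} {s₀ : S} {w : List α}
    {D : Type*} (f : D → D) (acc : D → Prop) (R : Conf K S → D → Prop) {x₀ : Conf K S} {d₀ : D}
    (h₀ : G₀.Exec w (s₀, 1, fun _ => 0) x₀) (hR₀ : R x₀ d₀)
    (hbound : ∀ x d, R x d → ∀ i, x.2.2 i ≤ w.length)
    (hacc : ∀ x d, R x d → (b x.1 = false ↔ acc d))
    (hG : ∀ x d, R x d → b x.1 = true → ∃ y, G.Exec w x y ∧ R y (f d)) (pol : OverflowPolicy) :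
    (∀ t, ¬ ((G₀.seq (loop (fun s _ _ => b s) G)).toMachine s₀).Overflows w
      (((G₀.seq (loop (fun s _ _ => b s) G)).toMachine s₀).run pol w t)) ∧
    (w ∈ ((G₀.seq (loop (fun s _ _ => b s) G)).toMachine s₀).accepts pol ↔
      ∃ t, acc (f^[t] d₀)) := by
  set P := G₀.seq (loop (fun s _ _ => b s) G)
  by_cases hex : ∃ t, acc (f^[t] d₀)
  · obtain ⟨t, ht⟩ := hex
    have key : ∀ t x d, R x d → acc (f^[t] d) →
        ∃ y, (loop (fun s _ _ => b s) G).Exec w x y ∧ ∀ i, y.2.2 i ≤ w.length := by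
      intro t
      induction t with
      | zero =>
        intro x d hx hd
        exact ⟨x, exec_loop_false (hbound x d hx) ((hacc x d hx).2 hd),
          hbound x d hx⟩
      | succ t ih =>
        intro x d hx hd
        cases hb : b x.1
        · exact ⟨x, exec_loop_false (hbound x d hx) hb, hbound x d hx⟩
        · obtain ⟨y, hy, hRy⟩ := hG x d hx hb
          obtain ⟨z, hz, hz'⟩ := ih y (f d) hRy hd
          exact ⟨z, exec_loop_true (hbound x d hx) hb hy hz, hz'⟩
    obtain ⟨y, hy, hy'⟩ := key t x₀ d₀ hR₀ ht
    obtain ⟨h₁, h₂⟩ := exec_run (s₀ := s₀) (h₀.seq hy) hy' pol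
    exact ⟨h₁, fun _ => ⟨t, ht⟩, fun _ => h₂⟩
  -- The checkpoints are the visits to the head of the main loop.
  · let Z : Set (Conf K (P.Control ⊕ S)) := {z | ∃ x d, R x d ∧ (∀ t, ¬ acc (f^[t] d)) ∧
      z = (.inl (.inr (.inr x.1)), x.2)}
    have hZ : ∀ z ∈ Z, ∃ z' ∈ Z, Relation.TransGen (P.Step w) z z' := by
      rintro _ ⟨x, d, hx, hd, rfl⟩
      have hb : b x.1 = true := by
        by_contra hb
        exact hd 0 ((hacc x d hx).1 (by simpa using hb))
      obtain ⟨y, hy, hRy⟩ := hG x d hx hb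
      refine ⟨_, ⟨y, f d, hRy, fun t => hd (t + 1), rfl⟩, ?_⟩
      have := transGen_loop (b := fun s _ _ => b s) (hbound x d hx) hb hy
      refine Relation.TransGen.lift (p := P.Step w)
        (fun x : Conf K ((loop (fun s _ _ => b s) G).Control ⊕ S) =>
        ((x.1.map .inr id, x.2) : Conf K (P.Control ⊕ S))) ?_ _ _ this
      rintro _ _ ⟨q, h, c, hc⟩
      exact Step.of_eq rfl hc
    have := fun t => chain_run (s₀ := s₀) hZ pol t (.inl (P.entry s₀), 1, fun _ => 0)
      ⟨_, ⟨x₀, d₀, hR₀, by simpa using hex, rfl⟩, seq_lift_left h₀⟩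
    refine ⟨fun t => (this t).1, fun ⟨t, ht⟩ => absurd ht (this t).2, fun h => absurd h hex⟩

end Gadget

/-! ### Renaming states -/

namespace CounterMachine

variable {α σ τ : Type*} {k : ℕ}

/-- Renaming the states of a counter machine. -/
def rename (M : CounterMachine α k σ) (e : σ ≃ τ) : CounterMachine α k τ where
  start := e M.start
  final := e.symm ⁻¹' M.final
  trans s y t := (e (M.trans (e.symm s) y t).1, (M.trans (e.symm s) y t).2)

theorem rename_run (M : CounterMachine α k σ) (e : σ ≃ τ) (pol : OverflowPolicy) (w : List α)
    (t : ℕ) : (M.rename e).run pol w t =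
      ⟨e (M.run pol w t).state, (M.run pol w t).head, (M.run pol w t).counter⟩ ∧
      ((M.rename e).Overflows w ((M.rename e).run pol w t) ↔ M.Overflows w (M.run pol w t)) := by
  have hov : ∀ c : CounterConfig k σ, (M.rename e).Overflows w ⟨e c.state, c.head, c.counter⟩ ↔
      M.Overflows w c := by
    intro c
    simp [Overflows, action, rename]
  have hstep : ∀ c : CounterConfig k σ,
      (M.rename e).step pol w ⟨e c.state, c.head, c.counter⟩ =
      ⟨e (M.step pol w c).state, (M.step pol w c).head, (M.step pol w c).counter⟩ := by
    intro c
    by_cases h : pol = .block ∧ M.Overflows w c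
    · rw [step, step, if_pos h, if_pos (by rwa [hov])]
    · rw [step, step, if_neg h, if_neg (by rwa [hov])]
      simp [action, rename]
  have hrun : (M.rename e).run pol w t =
      ⟨e (M.run pol w t).state, (M.run pol w t).head, (M.run pol w t).counter⟩ := by
    induction t with
    | zero => rfl
    | succ t ih =>
      rw [run, Function.iterate_succ_apply', ← run, ih, hstep, run, run,
        Function.iterate_succ_apply']
  exact ⟨hrun, by rw [hrun, hov]⟩

end CounterMachine

/-- The simulating machine remembers tape symbols, so its states live in the universe of the
alphabet; a finite state set can be moved to `Fin n`. -/
theorem AcceptedByCounters.of_finite {α σ : Type*} [Finite σ] {pol : OverflowPolicy} {k : ℕ}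
    {L : Language α} (M : CounterMachine α k σ) (hM : M.Admitted pol) (hL : M.accepts pol = L) :
    AcceptedByCounters pol k L := by
  obtain ⟨n, ⟨e⟩⟩ := Finite.exists_equiv_fin σ
  refine ⟨Fin n, inferInstance, M.rename e, fun hp w t => ?_, ?_⟩
  · rw [(M.rename_run e pol w t).2]
    exact hM hp w t
  · rw [← hL]
    ext w
    refine exists_congr fun t => ?_
    rw [(M.rename_run e pol w t).1]
    simp [CounterMachine.rename]

/-! ### Walks driven by a finite deterministic system -/

section Drift

variable {Q : Type*} (f : Q → Q) (v : Q → ℤ)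

/-- The displacement of a walk with increments `v` after `t` steps of `f` from `q`. -/
def displacement (q : Q) (t : ℕ) : ℤ := ∑ s ∈ Finset.range t, v (f^[s] q)

theorem displacement_zero (q : Q) : displacement f v q 0 = 0 := rfl

theorem displacement_add (q : Q) (s t : ℕ) :
    displacement f v q (s + t) = displacement f v q s + displacement f v (f^[s] q) t := by
  rw [displacement, Finset.sum_range_add, displacement, displacement]
  simp only [← Function.iterate_add_apply, Nat.add_comm]

theorem displacement_one (q : Q) : displacement f v q 1 = v q := by simp [displacement]

theorem abs_displacement_le (hv : ∀ q, |v q| ≤ 1) (q : Q) (t : ℕ) :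
    |displacement f v q t| ≤ t := by
  refine (Finset.abs_sum_le_sum_abs _ _).trans ?_
  refine (Finset.sum_le_sum fun s _ => hv _).trans ?_
  simp

/-- Over no time interval does the walk from `q` lose more than `N`. -/
def NoLoss (N : ℕ) (q : Q) : Prop := ∀ s t, -(N : ℤ) ≤ displacement f v (f^[s] q) t

theorem NoLoss.apply {N : ℕ} {q : Q} (h : NoLoss f v N q) : NoLoss f v N (f q) :=
  fun s t => h (s + 1) t

theorem NoLoss.mono {N N' : ℕ} {q : Q} (hN : N ≤ N') (h : NoLoss f v N q) : NoLoss f v N' q :=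
  fun s t => (by have := h s t; omega)

/-- Full periods do not lose, so any interval can be reduced by shifting its start back by one
period or removing its last period. What remains has length below `r + 2 * l` and unit steps. -/
theorem exists_noLoss_of_period (hv : ∀ q, |v q| ≤ 1) {q : Q} {r l : ℕ} (hl : 0 < l)
    (hper : f^[r + l] q = f^[r] q) (hd : 0 ≤ displacement f v (f^[r] q) l) :
    NoLoss f v (r + 2 * l) q := by
  have hper' : ∀ s, r ≤ s → f^[s + l] q = f^[s] q := by
    intro s hs
    obtain ⟨u, rfl⟩ := Nat.exists_eq_add_of_le hs
    rw [show r + u + l = u + (r + l) by omega, Function.iterate_add_apply, hper,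
      ← Function.iterate_add_apply, Nat.add_comm u r]
  -- A full period has the same displacement wherever it starts: decompose the walk from `r` to `s +
  -- l` in two ways.
  have hd' : ∀ s, r ≤ s → 0 ≤ displacement f v (f^[s] q) l := by
    intro s hs
    obtain ⟨u, rfl⟩ := Nat.exists_eq_add_of_le hs
    have h1 := displacement_add f v (f^[r] q) u l
    have h2 := displacement_add f v (f^[r] q) l u
    rw [← Function.iterate_add_apply, Nat.add_comm u r] at h1
    rw [← Function.iterate_add_apply, Nat.add_comm l r, hper] at h2
    rw [Nat.add_comm l u] at h2
    omega
  have key : ∀ n s t, s + t ≤ n → -((r + 2 * l : ℕ) : ℤ) ≤ displacement f v (f^[s] q) t := by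
    intro n
    induction n with
    | zero =>
      intro s t h
      obtain rfl : t = 0 := by omega
      rw [displacement_zero]
      omega
    | succ n ih =>
      intro s t h
      by_cases h1 : r + l ≤ s
      · have := ih (s - l) t (by omega)
        rwa [← hper' (s - l) (by omega), Nat.sub_add_cancel (by omega)] at this
      by_cases h2 : r + 2 * l ≤ s + t
      -- Since `s < r + l`, the interval is longer than a period, and its last period starts after
      -- `r`.
      · have h3 := ih s (t - l) (by omega)
        have h4 := hd' (s + (t - l)) (by omega)
        have h5 := displacement_add f v (f^[s] q) (t - l) l
        rw [Nat.sub_add_cancel (by omega), ← Function.iterate_add_apply,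
          Nat.add_comm (t - l) s] at h5
        omega
      · have := abs_le.1 (abs_displacement_le f v hv (f^[s] q) t)
        omega
  exact fun s t => key (s + t) s t le_rfl

theorem displacement_neg (q : Q) (t : ℕ) :
    displacement f (fun q => -v q) q t = -displacement f v q t := by
  simp [displacement]

/-- By pigeonhole the orbit becomes periodic; the sign of the displacement over one period decides
the direction. -/
theorem exists_noLoss [Finite Q] (hv : ∀ q, |v q| ≤ 1) (q : Q) :
    ∃ N, NoLoss f v N q ∨ NoLoss f (fun q => -v q) N q := by
  obtain ⟨m, n, hmn, h⟩ : ∃ m n, m < n ∧ f^[m] q = f^[n] q := by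
    obtain ⟨m, n, hne, h⟩ := Finite.exists_ne_map_eq_of_infinite fun t => f^[t] q
    rcases lt_or_gt_of_ne hne with h' | h'
    · exact ⟨m, n, h', h⟩
    · exact ⟨n, m, h', h.symm⟩
  have hper : f^[m + (n - m)] q = f^[m] q := by rw [Nat.add_sub_cancel' hmn.le, h]
  refine ⟨m + 2 * (n - m), ?_⟩
  rcases le_total 0 (displacement f v (f^[m] q) (n - m)) with hd | hd
  · exact .inl (exists_noLoss_of_period f v hv (by omega) hper hd)
  · refine .inr (exists_noLoss_of_period f _ (by simpa using hv) (by omega) hper ?_)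
    rw [displacement_neg]
    omega

end Drift

instance {α : Type*} [Finite α] : Finite (TapeSymbol α) := by
  let f : TapeSymbol α → Option (Option α)
    | .leftEnd => none
    | .rightEnd => some none
    | .letter a => some (some a)
  refine Finite.of_injective f ?_
  rintro (_ | _ | _) (_ | _ | _) h <;> simp_all [f]

/-- The sign of a movement. -/
def HeadMove.sign : HeadMove → ℤ
  | .left => -1
  | .stay => 0
  | .right => 1

/-- The sign of a movement, counted positively in the direction `d` (`true` is right). -/
def HeadMove.signTo (d : Bool) (m : HeadMove) : ℤ := if d then m.sign else -m.sign

namespace MultiHeadAutomaton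

variable {α σ : Type*} {k : ℕ} (M : MultiHeadAutomaton α k σ)

/-- As long as the automaton scans the symbols `x`, whatever it does to head `i` amounts, over any
time interval, to a displacement of at most `N` against the direction `d`. -/
def Drifts (N : ℕ) (x : Fin k → TapeSymbol α) (i : Fin k) (d : Bool) (q : σ) : Prop :=
  NoLoss (fun q => (M.trans q x).1) (fun q => ((M.trans q x).2 i).signTo d) N q

theorem exists_drifts [Finite σ] [Finite α] :
    ∃ N, ∀ q x i, ∃ d, M.Drifts N x i d q := by
  have hex : ∀ z : σ × (Fin k → TapeSymbol α) × Fin k, ∃ N, ∃ d, M.Drifts N z.2.1 z.2.2 d z.1 := by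
    rintro ⟨q, x, i⟩
    obtain ⟨N, h | h⟩ := exists_noLoss (fun q => (M.trans q x).1)
      (fun q => ((M.trans q x).2 i).sign) (by
        intro q
        cases (M.trans q x).2 i <;> simp [HeadMove.sign]) q
    · exact ⟨N, true, h⟩
    · exact ⟨N, false, h⟩
  choose N hN using hex
  obtain ⟨B, hB⟩ := Finite.exists_le N
  refine ⟨B, fun q x i => ?_⟩
  obtain ⟨d, hd⟩ := hN (q, x, i)
  exact ⟨d, hd.mono _ _ (hB _)⟩

end MultiHeadAutomaton

/-! ### Blocks of equal symbols on the tape -/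

/-- Every symbol occupies an interval of the tape `⊢ w ⊣`. -/
def IsBlockWord {α : Type*} (w : List α) : Prop :=
  ∀ a b c, a ≤ b → b ≤ c → c ≤ w.length + 1 → readTape w a = readTape w c →
    readTape w b = readTape w a

/-- The movement by one position in the direction `d` (`true` is right). -/
def dirMove (d : Bool) : HeadMove := if d then .right else .left

/-- The end-marker in the direction `d`. -/
def endSymbol (α : Type*) (d : Bool) : TapeSymbol α := if d then .rightEnd else .leftEnd

/-- The symbol is an input letter. -/
def TapeSymbol.IsLetter {α : Type*} : TapeSymbol α → Prop
  | .letter _ => True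
  | _ => False

section Tape

variable {α : Type*} (w : List α)

theorem readTape_zero : readTape w 0 = .leftEnd := rfl

theorem readTape_eq_leftEnd {p : ℕ} : readTape w p = .leftEnd ↔ p = 0 := by
  rcases p with _ | p
  · simp [readTape]
  · rcases lt_or_ge p w.length with h | h <;> simp [readTape, h]

theorem readTape_eq_rightEnd {p : ℕ} : readTape w p = .rightEnd ↔ w.length < p := by
  rcases p with _ | p
  · simp [readTape]
  · rcases lt_or_ge p w.length with h | h <;> simp [readTape, h]

theorem isLetter_readTape {p : ℕ} : (readTape w p).IsLetter ↔ 0 < p ∧ p ≤ w.length := by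
  have h1 := readTape_eq_leftEnd w (p := p)
  have h2 := readTape_eq_rightEnd w (p := p)
  cases h : readTape w p <;> simp [h, TapeSymbol.IsLetter] at * <;> omega

/-- The last position of the symbol `x` in the direction `d`. -/
noncomputable def blockEnd (d : Bool) (x : TapeSymbol α) : ℕ :=
  if d then sSup {p | p ≤ w.length + 1 ∧ readTape w p = x}
  else sInf {p | p ≤ w.length + 1 ∧ readTape w p = x}

/-- The distance from `p` to the end of its block in the direction `d`. -/
noncomputable def blockDist (d : Bool) (p : ℕ) : ℕ :=
  if d then blockEnd w true (readTape w p) - p else p - blockEnd w false (readTape w p)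

variable {w}

theorem blockEnd_spec (d : Bool) {p : ℕ} (hp : p ≤ w.length + 1) :
    blockEnd w d (readTape w p) ≤ w.length + 1 ∧
      readTape w (blockEnd w d (readTape w p)) = readTape w p := by
  have hne : {r | r ≤ w.length + 1 ∧ readTape w r = readTape w p}.Nonempty := ⟨p, hp, rfl⟩
  cases d
  · exact Nat.sInf_mem hne
  · exact Nat.sSup_mem hne ⟨w.length + 1, fun r hr => hr.1⟩

theorem le_blockEnd {p : ℕ} (hp : p ≤ w.length + 1) : p ≤ blockEnd w true (readTape w p) :=
  le_csSup (s := {r | r ≤ w.length + 1 ∧ readTape w r = readTape w p})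
    ⟨w.length + 1, fun _ hr => hr.1⟩ ⟨hp, rfl⟩

theorem blockEnd_le {p : ℕ} (hp : p ≤ w.length + 1) : blockEnd w false (readTape w p) ≤ p :=
  Nat.sInf_le (s := {r | r ≤ w.length + 1 ∧ readTape w r = readTape w p}) ⟨hp, rfl⟩

theorem IsBlockWord.readTape_eq (hw : IsBlockWord w) {p r : ℕ} (hp : p ≤ w.length + 1)
    (h₁ : blockEnd w false (readTape w p) ≤ r) (h₂ : r ≤ blockEnd w true (readTape w p)) :
    readTape w r = readTape w p := by
  have hl := blockEnd_spec false hp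
  have hr := blockEnd_spec true hp
  rw [hw _ _ _ h₁ h₂ hr.1 (by rw [hl.2, hr.2]), hl.2]

/-- The tape has `n + 2` positions, but the left end-marker occurs only once, so no block fills all
of them. This is what makes distances fit into bounded counters. -/
theorem blockEnd_bounds {p : ℕ} (hp : p ≤ w.length + 1) :
    blockEnd w true (readTape w p) ≤ blockEnd w false (readTape w p) + w.length := by
  have hl := blockEnd_spec false hp
  have hr := blockEnd_spec true hp
  have h1 := le_blockEnd hp
  have h2 := blockEnd_le hp
  by_contra hlt
  have hl0 : blockEnd w false (readTape w p) = 0 := by omega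
  have h3 := hr.2
  rw [← hl.2, hl0, readTape_zero, readTape_eq_leftEnd] at h3
  rw [← hl.2, hl0, readTape_zero] at hlt
  omega

theorem blockDist_le (d : Bool) {p : ℕ} (hp : p ≤ w.length + 1) : blockDist w d p ≤ w.length := by
  have h1 := le_blockEnd hp
  have h2 := blockEnd_le hp
  have h3 := blockEnd_bounds hp
  cases d <;> simp only [blockDist, Bool.false_eq_true, if_true, if_false] <;> omega

/-- The strict inequality leaves room for counting one step too far in `walk`. -/
theorem blockDist_lt_of_isLetter (d : Bool) {p : ℕ} (hp : p ≤ w.length + 1)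
    (h : (readTape w p).IsLetter) : blockDist w d p < w.length := by
  have h1 := le_blockEnd hp
  have h2 := blockEnd_le hp
  have hl := blockEnd_spec false hp
  have hr := blockEnd_spec true hp
  have h3 := (isLetter_readTape w).1 h
  have h4 := (isLetter_readTape w).1 (hl.2.symm ▸ h)
  have h5 := (isLetter_readTape w).1 (hr.2.symm ▸ h)
  cases d <;> simp only [blockDist, Bool.false_eq_true, if_true, if_false] <;> omega

theorem apply_le (m : HeadMove) {p : ℕ} (hp : p ≤ w.length + 1) :
    m.apply w.length p ≤ w.length + 1 := by
  cases m <;> simp only [HeadMove.apply] <;> omega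

theorem IsBlockWord.readTape_apply (hw : IsBlockWord w) {d : Bool} {p : ℕ} (hp : p ≤ w.length + 1)
    (h : 0 < blockDist w d p) :
    readTape w ((dirMove d).apply w.length p) = readTape w p := by
  have h1 := le_blockEnd hp
  have h2 := blockEnd_le hp
  have hr := blockEnd_spec true hp
  refine hw.readTape_eq hp ?_ ?_ <;> cases d <;>
    simp only [blockDist, dirMove, HeadMove.apply, Bool.false_eq_true, if_true, if_false] at * <;>
    omega

theorem IsBlockWord.blockDist_apply (hw : IsBlockWord w) {d : Bool} {p : ℕ}
    (hp : p ≤ w.length + 1) (h : 0 < blockDist w d p) :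
    blockDist w d ((dirMove d).apply w.length p) + 1 = blockDist w d p ∧
    blockDist w (!d) ((dirMove d).apply w.length p) = blockDist w (!d) p + 1 := by
  have h1 := le_blockEnd hp
  have h2 := blockEnd_le hp
  have hr := blockEnd_spec true hp
  have he := hw.readTape_apply hp h
  cases d <;> simp only [blockDist, he, Bool.not_true, Bool.not_false, Bool.false_eq_true,
    if_true, if_false] at * <;>
    simp only [dirMove, HeadMove.apply, Bool.false_eq_true, if_true, if_false] <;> omega

theorem blockDist_eq_zero {d : Bool} {p : ℕ} (hp : p ≤ w.length + 1) :
    blockDist w d p = 0 ↔ p = blockEnd w d (readTape w p) := by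
  have h1 := le_blockEnd hp
  have h2 := blockEnd_le hp
  cases d <;> simp only [blockDist, Bool.false_eq_true, if_true, if_false] <;> omega

theorem blockDist_blockEnd (d : Bool) {p : ℕ} (hp : p ≤ w.length + 1) :
    blockDist w d (blockEnd w d (readTape w p)) = 0 := by
  have h := blockEnd_spec d hp
  rw [blockDist_eq_zero h.1, h.2]

theorem readTape_apply_ne {d : Bool} {p : ℕ} (hp : p ≤ w.length + 1) (h : blockDist w d p = 0)
    (hne : readTape w p ≠ endSymbol α d) :
    readTape w ((dirMove d).apply w.length p) ≠ readTape w p := by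
  intro he
  have hp' := apply_le (w := w) (dirMove d) hp
  have h1 := le_blockEnd hp'
  have h2 := blockEnd_le hp'
  rw [he] at h1 h2
  rw [blockDist_eq_zero hp] at h
  cases d
  · have : p ≠ 0 := by
      rintro rfl
      exact hne rfl
    simp only [dirMove, HeadMove.apply, Bool.false_eq_true, if_false] at h1 h2
    omega
  · have : ¬ w.length < p := by
      rw [← readTape_eq_rightEnd]
      exact hne
    simp only [dirMove, HeadMove.apply, if_true] at h1 h2
    omega

theorem apply_of_endSymbol {d : Bool} {p : ℕ} (hp : p ≤ w.length + 1)
    (h : readTape w p = endSymbol α d) : (dirMove d).apply w.length p = p := by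
  cases d
  · rw [endSymbol, if_neg (by simp), readTape_eq_leftEnd] at h
    simp [dirMove, HeadMove.apply, h]
  · rw [endSymbol, if_pos rfl, readTape_eq_rightEnd] at h
    simp [dirMove, HeadMove.apply]
    omega

/-- Moving back after a move that changed the scanned symbol. -/
theorem apply_apply_of_ne {d : Bool} {p : ℕ} (hp : p ≤ w.length + 1)
    (h : readTape w ((dirMove d).apply w.length p) ≠ readTape w p) :
    (dirMove !d).apply w.length ((dirMove d).apply w.length p) = p := by
  have : readTape w p ≠ endSymbol α d := fun he => h (by rw [apply_of_endSymbol hp he])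
  cases d
  · simp only [endSymbol, Bool.false_eq_true, if_false, ne_eq, readTape_eq_leftEnd] at this
    simp only [dirMove, HeadMove.apply, Bool.false_eq_true, if_false, Bool.not_false, if_true]
    omega
  · simp only [endSymbol, if_true, ne_eq, readTape_eq_rightEnd] at this
    simp only [dirMove, HeadMove.apply, Bool.not_true, if_true, Bool.false_eq_true, if_false]
    omega

/-- A head that crosses a block end arrives at the adjacent end of the next block, so its position
remains known without a counter. Pushing against an end-marker also fits: the head stays, and the
marker is a block of one position. -/
theorem IsBlockWord.blockDist_cross (hw : IsBlockWord w) {d : Bool} {p : ℕ}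
    (hp : p ≤ w.length + 1) (h : blockDist w d p = 0) :
    blockDist w (!d) ((dirMove d).apply w.length p) = 0 := by
  by_cases hne : readTape w p = endSymbol α d
  · rw [apply_of_endSymbol hp hne]
    have h1 := blockEnd_spec (!d) hp
    rw [hne] at h1
    rw [blockDist_eq_zero hp, hne]
    cases d
    · simp only [endSymbol, Bool.false_eq_true, if_false, readTape_eq_leftEnd, Bool.not_false] at *
      omega
    · simp only [endSymbol, if_true, readTape_eq_rightEnd, Bool.not_true] at *
      omega
  · have hread := readTape_apply_ne hp h hne
    have hp' := apply_le (w := w) (dirMove d) hp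
    by_contra hpos
    apply hread
    have hback := hw.readTape_apply hp' (Nat.pos_of_ne_zero hpos)
    rw [apply_apply_of_ne hp hread] at hback
    exact hback.symm

/-- `p` is reached from `h` by `v` steps in the direction `d`. -/
def Reaches (d : Bool) (v h p : ℕ) : Prop := if d then h + v = p else p + v = h

theorem reaches_blockEnd (d : Bool) {p : ℕ} (hp : p ≤ w.length + 1) :
    Reaches (!d) (blockDist w d p) (blockEnd w d (readTape w p)) p := by
  have h1 := le_blockEnd hp
  have h2 := blockEnd_le hp
  cases d <;> simp only [Reaches, blockDist, Bool.not_true, Bool.not_false, Bool.false_eq_true,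
    if_true, if_false] <;> omega

theorem Reaches.apply {d : Bool} {v h p : ℕ} (hr : Reaches d (v + 1) h p)
    (hh : h ≤ w.length + 1) (hp : p ≤ w.length + 1) :
    Reaches d v ((dirMove d).apply w.length h) p := by
  cases d <;> simp only [Reaches, dirMove, HeadMove.apply, Bool.false_eq_true,
    if_true, if_false] at * <;> omega

end Tape

/-! ### Basic subroutines -/

section Counters

variable {K : ℕ}

/-- The value of a counter; there is an additional fictitious counter that is always zero. -/
def counterVal (c : Fin K → ℕ) : Option (Fin K) → ℕ
  | none => 0
  | some a => c a

/-- Setting a counter; setting the fictitious counter has no effect. -/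
def counterSet (c : Fin K → ℕ) (a : Option (Fin K)) (v : ℕ) : Fin K → ℕ :=
  fun j => if a = some j then v else c j

/-- Testing a counter for zero, given the results of all zero-tests. -/
def counterZero (t : Fin K → Bool) : Option (Fin K) → Bool
  | none => true
  | some a => t a

/-- Operating on a single counter. -/
def opAt (a : Option (Fin K)) (op : CounterOp) : Fin K → CounterOp :=
  fun j => if a = some j then op else .keep

theorem counterZero_eq (c : Fin K → ℕ) (a : Option (Fin K)) :
    counterZero (fun i => decide (c i = 0)) a = decide (counterVal c a = 0) := by
  cases a
  · simp [counterZero, counterVal]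
  · rfl

theorem opAt_apply (c : Fin K → ℕ) (a : Option (Fin K)) (op : CounterOp) (j : Fin K) :
    (opAt a op j).apply (c j) = counterSet c a (op.apply (counterVal c a)) j := by
  by_cases h : a = some j
  · subst h; simp [opAt, counterSet, counterVal]
  · simp [opAt, counterSet, h, CounterOp.apply]

theorem opAt_apply_counterSet (c : Fin K → ℕ) (a : Option (Fin K)) (op : CounterOp) (v : ℕ)
    (j : Fin K) : (opAt a op j).apply (counterSet c a v j) = counterSet c a (op.apply v) j := by
  by_cases h : a = some j <;> simp [opAt, counterSet, h, CounterOp.apply]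

theorem counterSet_le {n : ℕ} {c : Fin K → ℕ} (hc : ∀ i, c i ≤ n) (a : Option (Fin K)) {v : ℕ}
    (hv : v ≤ n) (i : Fin K) : counterSet c a v i ≤ n := by
  unfold counterSet
  split_ifs
  · exact hv
  · exact hc i

theorem counterSet_counterSet (c : Fin K → ℕ) (a : Option (Fin K)) (v v' : ℕ) :
    counterSet (counterSet c a v) a v' = counterSet c a v' := by
  funext j
  unfold counterSet
  split_ifs <;> rfl

theorem counterSet_val (c : Fin K → ℕ) (a : Option (Fin K)) :
    counterSet c a (counterVal c a) = c := by
  funext j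
  unfold counterSet
  split_ifs with h
  · subst h; rfl
  · rfl

theorem counterVal_counterSet_some (c : Fin K → ℕ) (a : Fin K) (v : ℕ) :
    counterVal (counterSet c (some a) v) (some a) = v := by
  simp [counterVal, counterSet]

theorem counterVal_counterSet_of_ne (c : Fin K → ℕ) {a b : Option (Fin K)} (h : a ≠ b) (v : ℕ) :
    counterVal (counterSet c a v) b = counterVal c b := by
  cases b with
  | none => rfl
  | some b => simp [counterVal, counterSet, h]

theorem counterVal_counterSet_self (c : Fin K → ℕ) (a : Option (Fin K)) {v : ℕ}
    (h : a = none → v = 0) : counterVal (counterSet c a v) a = v := by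
  cases a with
  | none => rw [h rfl]; rfl
  | some a => exact counterVal_counterSet_some c a v

end Counters

/-! ### Moving between block ends and stored positions -/

namespace Gadget

open scoped Classical in
/-- Moving to the end of the block of the symbol `X` in the direction `d`. -/
noncomputable def seek {α : Type*} {S : Type*} {K : ℕ} [Finite S] (d : S → Bool)
    (X : S → TapeSymbol α) : Gadget α K S :=
  (loop (fun s y _ => decide (y ≠ endSymbol α (d s)))
    (act fun s _ _ => (s, dirMove (d s), fun _ => .keep))).seq
  (loop (fun s y _ => decide (y ≠ X s))
    (act fun s _ _ => (s, dirMove (!d s), fun _ => .keep)))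

/-- Moving in the direction `d` and decrementing the counter `a` until it is zero; each step is
recorded in the memory by `bump`. -/
def drain {α : Type*} {S : Type*} {K : ℕ} [Finite S] (d : S → Bool) (a : S → Option (Fin K))
    (bump : S → S) : Gadget α K S :=
  loop (fun s _ t => !counterZero t (a s))
    (act fun s _ _ => (bump s, dirMove (d s), opAt (a s) .dec))

/-- Setting the counter `a` to zero. -/
def clear {α : Type*} {S : Type*} {K : ℕ} [Finite S] (a : S → Option (Fin K)) : Gadget α K S :=
  loop (fun s _ t => !counterZero t (a s)) (act fun s _ _ => (s, .stay, opAt (a s) .dec))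

open scoped Classical in
/-- Moving in the direction `d` to the end of the block of the symbol `X` and counting the steps
with the counter `a`. -/
noncomputable def walk {α : Type*} {S : Type*} {K : ℕ} [Finite S] (d : S → Bool)
    (X : S → TapeSymbol α) (a : S → Option (Fin K)) : Gadget α K S :=
  (loop (fun s y _ => decide (y = X s ∧ y.IsLetter))
    (act fun s _ _ => (s, dirMove (d s), opAt (a s) .inc))).seq
  (act fun s _ _ => if (X s).IsLetter then (s, dirMove (!d s), opAt (a s) .dec)
    else (s, .stay, fun _ => .keep))

variable {α : Type*} {S : Type*} {K : ℕ} [Finite S] {w : List α}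

theorem exec_move_until {b : S → TapeSymbol α → (Fin K → Bool) → Bool} {e : S → Bool} {d : Bool}
    {s : S} {c : Fin K → ℕ} {p : ℕ} (he : e s = d) (hc : ∀ i, c i ≤ w.length)
    (hp : p ≤ w.length + 1) (t : ℕ) :
    ∀ h, h ≤ w.length + 1 → Reaches d t h p →
    (∀ r u, u < t → Reaches d (u + 1) r p →
      b s (readTape w r) (fun i => decide (c i = 0)) = true) →
    b s (readTape w p) (fun i => decide (c i = 0)) = false →
    (loop b (act fun s _ _ => (s, dirMove (e s), fun _ => .keep))).Exec w (s, h, c) (s, p, c) := by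
  induction t with
  | zero =>
    intro h _ hr _ hb
    obtain rfl : h = p := by cases d <;> simp [Reaches] at hr <;> omega
    exact exec_loop_false hc hb
  | succ t ih =>
    intro h hh hr hb hb'
    refine exec_loop_true hc (hb h t (by omega) hr) (exec_act rfl (fun _ => rfl) hc) ?_
    rw [he]
    exact ih _ (apply_le _ hh) (hr.apply hh hp) (fun r u hu => hb r u (by omega)) hb'

/-- Coming back from the end-marker in direction `d`, the first occurrence of the symbol is its
outermost one, which is the block end. -/
theorem exec_seek {d : S → Bool} {X : S → TapeSymbol α} {s : S} {h p : ℕ} {c : Fin K → ℕ}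
    (hh : h ≤ w.length + 1) (hc : ∀ i, c i ≤ w.length) (hp : p ≤ w.length + 1)
    (hX : readTape w p = X s) :
    (seek d X).Exec w (s, h, c) (s, blockEnd w (d s) (X s), c) := by
  have hE := blockEnd_spec (w := w) (d s) hp
  rw [hX] at hE
  have hle : ∀ r, r ≤ w.length + 1 → readTape w r = X s →
      blockEnd w false (X s) ≤ r ∧ r ≤ blockEnd w true (X s) := by
    intro r hr hrX
    rw [← hrX]
    exact ⟨blockEnd_le hr, le_blockEnd hr⟩
  cases hd : d s
  · rw [hd] at hE
    refine Exec.seq (exec_move_until (p := 0) (t := h) hd hc (by omega) h hh ?_ ?_ ?_)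
      (exec_move_until (d := true) (t := blockEnd w false (X s)) (by simp [hd]) hc hE.1 0
        (by omega) ?_ ?_ ?_)
    · simp [Reaches]
    · intro r u _ hr
      simp only [Reaches, Bool.false_eq_true, if_false] at hr
      simp only [hd, endSymbol, Bool.false_eq_true, if_false, ne_eq, readTape_eq_leftEnd,
        decide_eq_true_eq]
      omega
    · simp [hd, endSymbol, readTape_zero]
    · simp [Reaches]
    · intro r u hu hr
      simp only [Reaches, if_true] at hr
      simp only [ne_eq, decide_eq_true_eq]
      intro hrX
      have := (hle r (by omega) hrX).1
      omega
    · simp [hE.2]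
  · rw [hd] at hE
    refine Exec.seq (exec_move_until (p := w.length + 1) (t := w.length + 1 - h) hd hc le_rfl h hh
        ?_ ?_ ?_)
      (exec_move_until (d := false) (t := w.length + 1 - blockEnd w true (X s)) (by simp [hd]) hc
        hE.1 (w.length + 1) le_rfl ?_ ?_ ?_)
    · simp [Reaches]; omega
    · intro r u _ hr
      simp only [Reaches, if_true] at hr
      simp only [hd, endSymbol, if_true, ne_eq, readTape_eq_rightEnd, decide_eq_true_eq]
      omega
    · simp [hd, endSymbol, readTape_eq_rightEnd]
    · simp [Reaches]; omega
    · intro r u hu hr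
      simp only [Reaches, Bool.false_eq_true, if_false] at hr
      simp only [ne_eq, decide_eq_true_eq]
      intro hrX
      have := (hle r (by omega) hrX).2
      omega
    · simp [hE.2]

/-- `Reaches` guarantees that the `v` moves are not cut short by an end-marker. Recording steps must
not alter the direction or the choice of counter. -/
theorem exec_drain {d : S → Bool} {a : S → Option (Fin K)} {bump : S → S}
    (hd : ∀ s, d (bump s) = d s) (ha : ∀ s, a (bump s) = a s) (v : ℕ) :
    ∀ {s : S} {h p : ℕ} {c : Fin K → ℕ}, h ≤ w.length + 1 → (∀ i, c i ≤ w.length) →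
    p ≤ w.length + 1 → counterVal c (a s) = v → Reaches (d s) v h p →
    (drain d a bump).Exec w (s, h, c) (bump^[v] s, p, counterSet c (a s) 0) := by
  induction v with
  | zero =>
    intro s h p c hh hc hp hv hr
    obtain rfl : h = p := by cases hd : d s <;> simp [Reaches, hd] at hr <;> omega
    rw [← hv, counterSet_val]
    simp only [hv, Function.iterate_zero, id]
    exact exec_loop_false hc (by simp [counterZero_eq, hv])
  | succ v ih =>
    intro s h p c hh hc hp hv hr
    refine exec_loop_true hc (by simp [counterZero_eq, hv])
      (exec_act rfl (opAt_apply c _ _) (counterSet_le hc _ ?_)) ?_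
    · have : counterVal c (a s) ≤ w.length := by
        cases h : a s with
        | none => simp [counterVal]
        | some b => exact hc b
      simp only [CounterOp.apply]
      omega
    · have hlt : counterVal c (a s) - 1 ≤ w.length := by
        cases h : a s with
        | none => simp [counterVal]
        | some b => have := hc b; simp only [counterVal]; omega
      have := @ih (bump s) ((dirMove (d s)).apply w.length h) p
        (counterSet c (a s) (CounterOp.dec.apply (counterVal c (a s)))) (apply_le _ hh)
        (counterSet_le hc _ hlt) hp (by
          rw [ha, counterVal_counterSet_self]
          · simp [CounterOp.apply, hv]
          · intro h; rw [h] at hv; simp [counterVal] at hv)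
        (by rw [hd]; exact hr.apply hh hp)
      rwa [ha, counterSet_counterSet, ← Function.iterate_succ_apply] at this

theorem exec_clear {a : S → Option (Fin K)} {s : S} {h : ℕ} {c : Fin K → ℕ}
    (hc : ∀ i, c i ≤ w.length) :
    (clear a).Exec w (s, h, c) (s, h, counterSet c (a s) 0) := by
  induction hv : counterVal c (a s) generalizing c with
  | zero =>
    rw [← hv, counterSet_val]
    exact exec_loop_false hc (by simp [counterZero_eq, hv])
  | succ v ih =>
    have hlt : CounterOp.dec.apply (counterVal c (a s)) ≤ w.length := by
      cases h : a s with
      | none => simp [counterVal, CounterOp.apply]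
      | some b => have := hc b; simp only [counterVal, CounterOp.apply]; omega
    refine exec_loop_true hc (by simp [counterZero_eq, hv])
      (exec_act rfl (opAt_apply c _ _) (counterSet_le hc _ hlt)) ?_
    have := ih (counterSet_le hc (a s) hlt) (by
      rw [counterVal_counterSet_self]
      · simp [CounterOp.apply, hv]
      · intro h; rw [h] at hv; simp [counterVal] at hv)
    rwa [counterSet_counterSet] at this

-- The end of a block of letters is noticed only after stepping out of it, so the walk goes one step
-- too far and takes that step back. End-markers are treated separately, since pushing against one
-- would never change the symbol.
open scoped Classical in
theorem exec_walk (hw : IsBlockWord w) {d : S → Bool} {X : S → TapeSymbol α}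
    {a : S → Option (Fin K)} {s : S} {p : ℕ} {c : Fin K → ℕ} (hp : p ≤ w.length + 1)
    (hX : readTape w p = X s) (hc : ∀ i, c i ≤ w.length) (h0 : counterVal c (a s) = 0) :
    (walk d X a).Exec w (s, p, c)
      (s, blockEnd w (d s) (X s), counterSet c (a s) (blockDist w (d s) p)) := by
  by_cases hl : (X s).IsLetter
  · have key : ∀ t r v, r ≤ w.length + 1 → readTape w r = X s → blockDist w (d s) r = t →
        v + t < w.length → (loop (fun s y _ => decide (y = X s ∧ y.IsLetter))
        (act fun s _ _ => (s, dirMove (d s), opAt (a s) .inc))).Exec w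
        (s, r, counterSet c (a s) v)
        (s, (dirMove (d s)).apply w.length (blockEnd w (d s) (X s)),
          counterSet c (a s) (v + t + 1)) := by
      intro t
      induction t with
      | zero =>
        intro r v hr hrX hdist hv
        have hre : r = blockEnd w (d s) (X s) := by rw [← hrX, ← blockDist_eq_zero hr, hdist]
        refine exec_loop_true (counterSet_le hc _ (by omega)) (by simp [hrX, hl])
          (exec_act rfl (opAt_apply_counterSet c _ _ v) (counterSet_le hc _ hv)) ?_
        rw [← hre]
        refine exec_loop_false (counterSet_le hc _ hv) ?_
        have hne : readTape w r ≠ endSymbol α (d s) := by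
          intro h
          rw [hrX] at h
          rw [h] at hl
          cases hd : d s <;> simp [endSymbol, hd, TapeSymbol.IsLetter] at hl
        have := readTape_apply_ne hr hdist hne
        rw [hrX] at this
        simp [this]
      | succ t ih =>
        intro r v hr hrX hdist hv
        refine exec_loop_true (counterSet_le hc _ (by omega)) (by simp [hrX, hl])
          (exec_act rfl (opAt_apply_counterSet c _ _ v)
            (counterSet_le hc _ (by simp only [CounterOp.apply]; omega))) ?_
        have h1 := hw.readTape_apply hr (d := d s) (by omega)
        have h2 := (hw.blockDist_apply hr (d := d s) (by omega)).1
        have := ih _ (v + 1) (apply_le (dirMove (d s)) hr) (h1.trans hrX) (by omega) (by omega)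
        rwa [show v + 1 + t + 1 = v + (t + 1) + 1 by omega] at this
    have hlt := blockDist_lt_of_isLetter (d s) hp (by rwa [hX])
    have h1 := key _ p 0 hp hX rfl (by omega)
    rw [← h0, counterSet_val, h0, Nat.zero_add] at h1
    refine h1.seq ?_
    have hE := blockEnd_spec (w := w) (d s) hp
    have hne : readTape w p ≠ endSymbol α (d s) := by
      intro h
      rw [hX] at h
      rw [h] at hl
      cases hd : d s <;> simp [endSymbol, hd, TapeSymbol.IsLetter] at hl
    -- The step out of the block really moved the head, so the opposite move undoes it.
    have hback := apply_apply_of_ne hE.1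
      (readTape_apply_ne hE.1 (blockDist_blockEnd (d s) hp) (by rwa [hE.2]))
    rw [hX] at hback
    have h2 := exec_act (w := w) (s := s) (h := (dirMove (d s)).apply w.length
      (blockEnd w (d s) (X s))) (c := counterSet c (a s) (blockDist w (d s) p + 1))
      (f := fun s _ _ => if (X s).IsLetter then (s, dirMove (!d s), opAt (a s) .dec)
        else (s, .stay, fun _ => .keep)) (by rw [if_pos hl])
      (opAt_apply_counterSet c _ _ _) (counterSet_le hc _ (by simp only [CounterOp.apply]; omega))
    rwa [hback] at h2
  -- Each end-marker occupies a single position.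
  · have hsing : blockDist w (d s) p = 0 := by
      have h1 := le_blockEnd hp
      have h2 := blockEnd_le hp
      have h3 := blockEnd_spec false hp
      have h4 := blockEnd_spec true hp
      have h5 : ∀ r, r ≤ w.length + 1 → readTape w r = readTape w p → r = p := by
        intro r hr hrp
        rw [← hX, isLetter_readTape] at hl
        have h6 : ¬ (readTape w r).IsLetter := by rw [hrp, isLetter_readTape]; exact hl
        rw [isLetter_readTape] at h6
        have h7 := readTape_eq_leftEnd w (p := p)
        have h8 := readTape_eq_leftEnd w (p := r)
        rw [hrp, h7] at h8
        omega
      rw [blockDist_eq_zero hp]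
      cases d s
      · exact (h5 _ h3.1 h3.2).symm
      · exact (h5 _ h4.1 h4.2).symm
    have hpe := (blockDist_eq_zero hp).1 hsing
    rw [hX] at hpe
    rw [hsing, ← hpe, ← h0, counterSet_val]
    refine (exec_loop_false hc (by simp [hX, hl])).seq ?_
    exact exec_act (m := .stay) (by rw [if_neg hl]) (fun _ => rfl) hc

end Gadget

/-! ### Simulating heads by counters: memory and storage of positions -/

/-- The finite memory of the machine that simulates an automaton with `K + 1` heads.
* `q` is the simulated state, `x i` the symbol scanned by head `i`;
* `e` assigns a counter to every head but one, which is the *free* head;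
* `dir i` is the side from which the position of head `i` in its block is measured;
* `near i` is the distance of head `i` from the other side, cut off at `N`;
* `mv` are the movements to be carried out, `t` is an auxiliary variable cut off at `N`, and `ev`
  is a head that is about to leave its block;
* `ok`, `seen` and `last` are used for the initial check of the input. -/
structure Mem (α σ : Type*) (K N : ℕ) where
  q : σ
  x : Fin (K + 1) → TapeSymbol α
  e : Fin (K + 1) ≃ Option (Fin K)
  dir : Fin (K + 1) → Bool
  near : Fin (K + 1) → Fin (N + 1)
  mv : Fin (K + 1) → HeadMove
  t : Fin (N + 1)
  ev : Option (Fin (K + 1))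
  ok : Bool
  seen : Set (TapeSymbol α)
  last : TapeSymbol α

instance : Finite HeadMove := by
  let f : HeadMove → Option Bool
    | .left => some false
    | .stay => none
    | .right => some true
  refine Finite.of_injective f ?_
  rintro (_ | _ | _) (_ | _ | _) h <;> simp_all [f]

instance {α σ : Type*} {K N : ℕ} [Finite α] [Finite σ] : Finite (Mem α σ K N) := by
  let f (s : Mem α σ K N) := (s.q, s.x, s.e, s.dir, s.near, s.mv, s.t, s.ev, s.ok, s.seen, s.last)
  refine Finite.of_injective f ?_
  rintro ⟨⟩ ⟨⟩ h
  simp_all [f]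

/-- Cutting off a number at `N`. -/
def cutoff (N v : ℕ) : Fin (N + 1) := ⟨min N v, by omega⟩

/-- The direction of a movement. -/
def HeadMove.side : HeadMove → Bool
  | .right => true
  | _ => false

theorem side_dirMove (d : Bool) : (dirMove d).side = d := by
  cases d <;> rfl

theorem eq_dirMove_or (m : HeadMove) (d : Bool) :
    m = dirMove d ∨ m = dirMove (!d) ∨ m = .stay := by
  cases m <;> cases d <;> simp [dirMove]

namespace Mem

variable {α σ : Type*} {K N : ℕ}

/-- The head that is not assigned to a counter. -/
def free (s : Mem α σ K N) : Fin (K + 1) := s.e.symm none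

theorem e_free (s : Mem α σ K N) : s.e s.free = none := s.e.apply_symm_apply none

/-- Counting one step. -/
def bump (s : Mem α σ K N) : Mem α σ K N := { s with t := cutoff N (s.t + 1) }

theorem bump_iterate (v : ℕ) (s : Mem α σ K N) :
    bump^[v] s = { s with t := cutoff N (s.t + v) } := by
  induction v with
  | zero =>
    have : cutoff N s.t = s.t := Fin.ext (by simp [cutoff]; omega)
    simp [this]
  | succ v ih =>
    rw [Function.iterate_succ_apply', ih]
    simp only [bump, cutoff, Mem.mk.injEq, true_and, and_true]
    refine Fin.ext ?_
    simp only
    omega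

end Mem

/-- The counters and the memory store the head positions `p`; the free head is at the end of its
block. -/
structure Stored {α σ : Type*} {K N : ℕ} (w : List α) (s : Mem α σ K N) (c : Fin K → ℕ)
    (p : Fin (K + 1) → ℕ) : Prop where
  pos : ∀ i, p i ≤ w.length + 1
  sym : ∀ i, s.x i = readTape w (p i)
  val : ∀ i, counterVal c (s.e i) = blockDist w (s.dir i) (p i)

/-- Every counter belongs to some head, so it holds a distance within a block. -/
theorem Stored.counter_le {α σ : Type*} {K N : ℕ} {w : List α}
    {s : Mem α σ K N} {c : Fin K → ℕ} {p : Fin (K + 1) → ℕ}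
    (h : Stored w s c p) (a : Fin K) : c a ≤ w.length := by
  have h1 := h.val (s.e.symm (some a))
  rw [s.e.apply_symm_apply] at h1
  have h2 := blockDist_le (s.dir (s.e.symm (some a))) (h.pos (s.e.symm (some a)))
  rw [← h1] at h2
  exact h2

/-! ### Loading, moving and re-measuring a single head -/

namespace Gadget

universe u v

variable {α : Type u} {σ : Type v} {K N : ℕ} [Finite α] [Finite σ] {w : List α}

/-- Emptying the counter of head `i` while moving in the direction `d`, measuring its value. -/
def fetch (d : Mem α σ K N → Bool) (i : Fin (K + 1)) : Gadget α K (Mem α σ K N) :=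
  (act fun s _ _ => ({ s with t := 0 }, .stay, fun _ => .keep)).seq
    (drain d (fun s => s.e i) Mem.bump)

theorem exec_fetch {d : Mem α σ K N → Bool} (hd : ∀ s v, d { s with t := v } = d s)
    {i : Fin (K + 1)} {s : Mem α σ K N} {h p : ℕ} {c : Fin K → ℕ} (hh : h ≤ w.length + 1)
    (hc : ∀ a, c a ≤ w.length) (hp : p ≤ w.length + 1)
    (hr : Reaches (d s) (counterVal c (s.e i)) h p) :
    (fetch d i).Exec w (s, h, c)
      ({ s with t := cutoff N (counterVal c (s.e i)) }, p, counterSet c (s.e i) 0) := by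
  refine (exec_keep_stay { s with t := 0 } rfl hc).seq ?_
  have := exec_drain (w := w) (d := d) (a := fun s : Mem α σ K N => s.e i) (bump := Mem.bump)
    (fun s => hd s _) (fun s => rfl) (counterVal c (s.e i)) (s := { s with t := 0 }) hh hc hp rfl
    (by rwa [hd])
  rw [Mem.bump_iterate] at this
  simpa using this

/-- Moving to the stored position of head `i` and emptying its counter. -/
noncomputable def load (i : Fin (K + 1)) : Gadget α K (Mem α σ K N) :=
  (seek (fun s => s.dir i) (fun s => s.x i)).seq (fetch (fun s => !s.dir i) i)

theorem exec_load {s : Mem α σ K N} {c : Fin K → ℕ} {p : Fin (K + 1) → ℕ} (hs : Stored w s c p)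
    {h : ℕ} (hh : h ≤ w.length + 1) (i : Fin (K + 1)) :
    ∃ v, (load i).Exec w (s, h, c) ({ s with t := v }, p i, counterSet c (s.e i) 0) := by
  refine ⟨_, (exec_seek (d := fun s : Mem α σ K N => s.dir i) (X := fun s : Mem α σ K N => s.x i)
    hh hs.counter_le (hs.pos i) (hs.sym i).symm).seq (exec_fetch (fun _ _ => rfl) ?_ hs.counter_le (hs.pos i) ?_)⟩
  · rw [hs.sym]
    exact (blockEnd_spec _ (hs.pos i)).1
  · rw [hs.sym, hs.val]
    exact reaches_blockEnd _ (hs.pos i)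

open scoped Classical in
/-- Carrying out the pending movement of head `i`. -/
noncomputable def advance (i : Fin (K + 1)) : Gadget α K (Mem α σ K N) :=
  (load i).seq <| (act fun s _ _ => (s, s.mv i, fun _ => .keep)).seq <|
  (act fun s y _ => ({ s with
    x := Function.update s.x i y
    dir := Function.update s.dir i (if s.e i = none then !(s.mv i).side else false) }, .stay,
    fun _ => .keep)).seq <|
  walk (fun s => s.dir i) (fun s => s.x i) (fun s => s.e i)

/-- The free head has no counter for its new distance, hence `hfree`: it must be the head that
pushes across a block end, so that its new distance from the side it came from is zero. For the
other heads the side is chosen arbitrarily; `settle` corrects it. -/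
theorem exec_advance (hw : IsBlockWord w) {s : Mem α σ K N} {c : Fin K → ℕ}
    {p : Fin (K + 1) → ℕ} (hs : Stored w s c p) {h : ℕ} (hh : h ≤ w.length + 1) (i : Fin (K + 1))
    (hfree : s.e i = none → ∃ d, s.mv i = dirMove d ∧ blockDist w d (p i) = 0) :
    ∃ s' h' c', (advance i).Exec w (s, h, c) (s', h', c') ∧ h' ≤ w.length + 1 ∧
      Stored w s' c' (Function.update p i ((s.mv i).apply w.length (p i))) ∧
      s'.q = s.q ∧ s'.e = s.e ∧ s'.mv = s.mv ∧ s'.ok = s.ok := by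
  classical
  obtain ⟨v, hload⟩ := exec_load hs hh i
  have hc0 : ∀ a, counterSet c (s.e i) 0 a ≤ w.length :=
    counterSet_le hs.counter_le _ (by omega)
  have hp' := apply_le (w := w) (s.mv i) (hs.pos i)
  let s' : Mem α σ K N := { s with
    t := v
    x := Function.update s.x i (readTape w ((s.mv i).apply w.length (p i)))
    dir := Function.update s.dir i (if s.e i = none then !(s.mv i).side else false) }
  have hwalk := exec_walk (K := K) hw (d := fun s : Mem α σ K N => s.dir i)
    (X := fun s : Mem α σ K N => s.x i)
    (a := fun s : Mem α σ K N => s.e i) (s := s') (c := counterSet c (s.e i) 0) hp' (by simp [s'])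
    hc0 (counterVal_counterSet_self _ _ (fun _ => rfl))
  refine ⟨s', _, _, hload.seq <| (exec_keep { s with t := v } (s.mv i) rfl hc0).seq <|
    (exec_keep_stay s' rfl hc0).seq hwalk, ?_, ⟨?_, ?_, ?_⟩, rfl, rfl, rfl, rfl⟩
  · simp only [s', Function.update_self]
    exact (blockEnd_spec _ hp').1
  · intro j
    by_cases hj : j = i
    · subst hj; simpa using hp'
    · simpa [hj] using hs.pos j
  · intro j
    by_cases hj : j = i
    · subst hj; simp [s']
    · simpa [hj, s'] using hs.sym j
  · intro j
    rw [counterSet_counterSet]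
    by_cases hj : j = i
    · subst hj
      simp only [Function.update_self, s']
      rw [counterVal_counterSet_self]
      intro hn
      obtain ⟨d, hd, hd0⟩ := hfree hn
      rw [if_pos hn, hd, side_dirMove]
      exact hw.blockDist_cross (hs.pos j) hd0
    · simp only [Function.update_of_ne hj, s']
      rw [counterVal_counterSet_of_ne, hs.val]
      exact fun h => hj (s.e.injective h.symm)

open scoped Classical in
/-- Changing the side from which head `i` is measured to the one given by `good`, and measuring the
distance from the other side up to the cutoff. -/
noncomputable def measure (good : σ → (Fin (K + 1) → TapeSymbol α) → Fin (K + 1) → Bool)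
    (i : Fin (K + 1)) : Gadget α K (Mem α σ K N) :=
  (load i).seq <|
  (walk (fun s => !good s.q s.x i) (fun s => s.x i) (fun s => s.e i)).seq <|
  (fetch (fun s => good s.q s.x i) i).seq <|
  (act fun s _ _ => ({ s with
    near := Function.update s.near i s.t
    dir := Function.update s.dir i (if s.e i = none then s.dir i else good s.q s.x i) }, .stay,
    fun _ => .keep)).seq <|
  walk (fun s => good s.q s.x i) (fun s => s.x i) (fun s => s.e i)

/-- A walk to the wrong end and back reads off the distance from that end up to the cutoff, with the
counter of the head itself as scratch space; a second walk stores the distance from the good end. -/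
theorem exec_measure (hw : IsBlockWord w)
    (good : σ → (Fin (K + 1) → TapeSymbol α) → Fin (K + 1) → Bool) {s : Mem α σ K N}
    {c : Fin K → ℕ} {p : Fin (K + 1) → ℕ} (hs : Stored w s c p) {h : ℕ} (hh : h ≤ w.length + 1)
    (i : Fin (K + 1)) :
    ∃ s' h' c', (measure good i).Exec w (s, h, c) (s', h', c') ∧ h' ≤ w.length + 1 ∧
      Stored w s' c' p ∧ s'.q = s.q ∧ s'.x = s.x ∧ s'.e = s.e ∧ s'.ok = s.ok ∧
      (s.e i ≠ none → s'.dir i = good s.q s.x i ∧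
        s'.near i = cutoff N (blockDist w (!good s.q s.x i) (p i))) ∧
      ∀ j, j ≠ i → s'.dir j = s.dir j ∧ s'.near j = s.near j := by
  classical
  obtain ⟨v, hload⟩ := exec_load hs hh i
  set d := good s.q s.x i with hd
  set c₀ := counterSet c (s.e i) 0 with hc₀
  have hc0 : ∀ a, c₀ a ≤ w.length := counterSet_le hs.counter_le _ (by omega)
  have h0 : counterVal c₀ (s.e i) = 0 := counterVal_counterSet_self _ _ (fun _ => rfl)
  have hpi := hs.pos i
  have hwalk := exec_walk (K := K) hw (d := fun s : Mem α σ K N => !good s.q s.x i)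
    (X := fun s : Mem α σ K N => s.x i)
    (a := fun s : Mem α σ K N => s.e i) (s := { s with t := v }) (c := c₀) hpi (hs.sym i).symm
    hc0 h0
  simp only [← hd] at hwalk
  set c₁ := counterSet c₀ (s.e i) (blockDist w (!d) (p i)) with hc₁
  have hc1 : ∀ a, c₁ a ≤ w.length := counterSet_le hc0 _ (blockDist_le _ hpi)
  have hE := blockEnd_spec (!d) hpi
  rw [← hs.sym i] at hE
  -- `r` is where the way back ends. The fictitious counter of the free head does not lead back from
  -- the block end, which is harmless because nothing has to be stored for it.
  obtain ⟨r, hr1, hr2, hr3, hr4⟩ : ∃ r, r ≤ w.length + 1 ∧ readTape w r = s.x i ∧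
      Reaches d (counterVal c₁ (s.e i)) (blockEnd w (!d) (s.x i)) r ∧
      (s.e i ≠ none → r = p i) := by
    by_cases hn : s.e i = none
    · refine ⟨blockEnd w (!d) (s.x i), hE.1, hE.2, ?_, fun h => absurd hn h⟩
      rw [hn]
      cases d <;> simp [Reaches, counterVal]
    · refine ⟨p i, hpi, (hs.sym i).symm, ?_, fun _ => rfl⟩
      rw [hc₁, counterVal_counterSet_self _ _ (fun h => absurd h hn), hs.sym i]
      simpa using reaches_blockEnd (!d) hpi
  have hfetch := exec_fetch (w := w) (d := fun s : Mem α σ K N => good s.q s.x i)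
    (fun _ _ => rfl) (i := i) (s := { s with t := v }) hE.1 hc1 hr1 hr3
  simp only at hfetch
  set c₂ := counterSet c₁ (s.e i) 0 with hc₂
  have hc2 : ∀ a, c₂ a ≤ w.length := counterSet_le hc1 _ (by omega)
  let s' : Mem α σ K N := { s with
    t := cutoff N (counterVal c₁ (s.e i))
    near := Function.update s.near i (cutoff N (counterVal c₁ (s.e i)))
    dir := Function.update s.dir i (if s.e i = none then s.dir i else d) }
  have hwalk' := exec_walk (K := K) hw (d := fun s : Mem α σ K N => good s.q s.x i)
    (X := fun s : Mem α σ K N => s.x i)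
    (a := fun s : Mem α σ K N => s.e i) (s := s') (c := c₂) hr1 hr2
    hc2 (counterVal_counterSet_self _ _ (fun _ => rfl))
  refine ⟨s', _, _, hload.seq <| hwalk.seq <| hfetch.seq <|
    (exec_keep_stay s' rfl hc2).seq hwalk', ?_, ⟨hs.pos, hs.sym, ?_⟩,
    rfl, rfl, rfl, rfl, ?_, ?_⟩
  · have := blockEnd_spec (w := w) d hpi
    rw [← hs.sym i] at this
    exact this.1
  · intro j
    simp only [s', hc₂, hc₁, hc₀, counterSet_counterSet]
    by_cases hj : j = i
    · subst hj
      by_cases hn : s.e j = none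
      · have := hs.val j
        simpa [hn, counterVal] using this
      · rw [counterVal_counterSet_self _ _ (fun h => absurd h hn), hr4 hn]
        simp [hn, hd]
    · rw [counterVal_counterSet_of_ne _ (fun h => hj (s.e.injective h.symm)), hs.val,
        Function.update_of_ne hj]
  · intro hn
    simp only [s', Function.update_self, if_neg hn, true_and]
    rw [hc₁, counterVal_counterSet_self _ _ (fun h => absurd h hn)]
  · intro j hj
    simp [s', hj]

end Gadget

/-! ### Simulating heads by counters: one round -/

namespace MultiHeadAutomaton

variable {α σ : Type*} {k : ℕ} (M : MultiHeadAutomaton α k σ)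

/-- As long as the automaton scans the symbols `x`, head `i` cannot lose more than `v` against the
direction `d`. -/
def Safe (x : Fin k → TapeSymbol α) (i : Fin k) (d : Bool) (q : σ) (v : ℕ) : Prop :=
  ∀ t, 0 ≤ v + displacement (fun q => (M.trans q x).1)
    (fun q => ((M.trans q x).2 i).signTo d) q t

variable {M} {x : Fin k → TapeSymbol α} {i : Fin k} {d : Bool} {q : σ}

/-- This is why cutting off at `N` loses nothing: a distance of at least `N` cannot be used up while
the symbols stay the same. -/
theorem Drifts.safe {N : ℕ} (h : M.Drifts N x i d q) : M.Safe x i d q N := by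
  intro t
  have := h 0 t
  simp only [Function.iterate_zero, id] at this
  omega

theorem Safe.next {v v' : ℕ} (h : M.Safe x i d q v)
    (hv : (v' : ℤ) = v + ((M.trans q x).2 i).signTo d) : M.Safe x i d (M.trans q x).1 v' := by
  intro t
  have := h (1 + t)
  rw [displacement_add, displacement_one] at this
  simp only [Function.iterate_one] at this
  omega

theorem Safe.nonneg {v : ℕ} (h : M.Safe x i d q v) : 0 ≤ v + ((M.trans q x).2 i).signTo d := by
  have := h 1
  rwa [displacement_one] at this

end MultiHeadAutomaton

theorem signTo_dirMove (d : Bool) : (dirMove d).signTo d = 1 := by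
  cases d <;> simp [dirMove, HeadMove.signTo, HeadMove.sign]

theorem signTo_dirMove_not (d : Bool) : (dirMove !d).signTo d = -1 := by
  cases d <;> simp [dirMove, HeadMove.signTo, HeadMove.sign]

theorem signTo_stay (d : Bool) : HeadMove.stay.signTo d = 0 := by
  cases d <;> simp [HeadMove.signTo, HeadMove.sign]

theorem dirMove_not_ne (d : Bool) : dirMove (!d) ≠ dirMove d := by
  cases d <;> simp [dirMove]

theorem stay_ne_dirMove (d : Bool) : HeadMove.stay ≠ dirMove d := by
  cases d <;> simp [dirMove]

/-- The cut-off distance `v` of a head at position `p` from the end of its block against the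
direction `d` is good enough to detect when the head leaves the block at that end. -/
structure NearInv {α σ : Type*} {k : ℕ} (M : MultiHeadAutomaton α k σ) (w : List α) (N : ℕ)
    (x : Fin k → TapeSymbol α) (i : Fin k) (d : Bool) (q : σ) (p v : ℕ) : Prop where
  drifts : M.Drifts N x i d q
  le : v ≤ blockDist w (!d) p
  eq_or_safe : v = blockDist w (!d) p ∨ M.Safe x i d q v

/-- Following a head that stays in its block. -/
theorem NearInv.follow {α σ : Type*} {K N : ℕ} {w : List α} (hw : IsBlockWord w)
    {M : MultiHeadAutomaton α (K + 1) σ}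
    {x : Fin (K + 1) → TapeSymbol α} {i : Fin (K + 1)} {d : Bool} {q : σ} {p : ℕ} {v : Fin (N + 1)}
    (hp : p ≤ w.length + 1) (hn : NearInv M w N x i d q p v) {m : HeadMove}
    (hm : (M.trans q x).2 i = m) (h₁ : ¬ (m = dirMove d ∧ blockDist w d p = 0))
    (h₂ : ¬ (m = dirMove (!d) ∧ v = 0)) :
    readTape w (m.apply w.length p) = readTape w p ∧
    (m = dirMove d → blockDist w d (m.apply w.length p) = blockDist w d p - 1 ∧
      NearInv M w N x i d (M.trans q x).1 (m.apply w.length p) (cutoff N (v + 1))) ∧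
    (m = dirMove (!d) → blockDist w d (m.apply w.length p) = blockDist w d p + 1 ∧
      NearInv M w N x i d (M.trans q x).1 (m.apply w.length p) (cutoff N (v - 1))) ∧
    (m = .stay → NearInv M w N x i d (M.trans q x).1 (m.apply w.length p) v) := by
  have hdr := hn.drifts.apply
  rcases eq_dirMove_or m d with rfl | rfl | rfl
  · have hpos : 0 < blockDist w d p := Nat.pos_of_ne_zero fun h => h₁ ⟨rfl, h⟩
    obtain ⟨e1, e2⟩ := hw.blockDist_apply hp hpos
    refine ⟨hw.readTape_apply hp hpos, fun _ => ⟨by omega, hdr, ?_, ?_⟩,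
      fun h => absurd h.symm (dirMove_not_ne d), fun h => absurd h.symm (stay_ne_dirMove d)⟩
    · have := hn.le
      simp only [cutoff]
      omega
    -- At the cutoff the distance may cease to be exact, but the value `N` is safe by the drift
    -- bound.
    · by_cases hN : (v : ℕ) + 1 ≤ N
      · have hv : ((cutoff N (v + 1) : Fin (N + 1)) : ℕ) = v + 1 := by simp [cutoff, hN]
        rw [hv]
        rcases hn.eq_or_safe with h | h
        · left; omega
        · right
          exact h.next (by rw [hm, signTo_dirMove]; push_cast; rfl)
      · right
        have hv : ((cutoff N (v + 1) : Fin (N + 1)) : ℕ) = N := by simp [cutoff]; omega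
        rw [hv]
        exact MultiHeadAutomaton.Drifts.safe hdr
  · have hv0 : (v : ℕ) ≠ 0 := fun h => h₂ ⟨rfl, Fin.ext h⟩
    have hle := hn.le
    have hpos : 0 < blockDist w (!d) p := by omega
    obtain ⟨e1, e2⟩ := hw.blockDist_apply hp hpos
    rw [Bool.not_not] at e2
    have hv : ((cutoff N (v - 1) : Fin (N + 1)) : ℕ) = v - 1 := by simp [cutoff]
    refine ⟨hw.readTape_apply hp hpos, fun h => absurd h (dirMove_not_ne d),
      fun _ => ⟨e2, hdr, by omega, ?_⟩, fun h => absurd h.symm (stay_ne_dirMove _)⟩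
    rw [hv]
    rcases hn.eq_or_safe with h | h
    · left; omega
    · right
      exact h.next (by rw [hm, signTo_dirMove_not]; omega)
  · refine ⟨rfl, fun h => absurd h (stay_ne_dirMove _), fun h => absurd h (stay_ne_dirMove _),
      fun _ => ⟨hdr, hn.le, ?_⟩⟩
    rcases hn.eq_or_safe with h | h
    · exact .inl h
    · exact .inr (h.next (by rw [hm, signTo_stay]; omega))

/-- Between two crossings of block ends, the input head is at the position of the free head. -/
structure Phase {α σ : Type*} {K N : ℕ} (M : MultiHeadAutomaton α (K + 1) σ) (w : List α)
    (a : Conf K (Mem α σ K N)) (C : MultiHeadConfig (K + 1) σ) : Prop where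
  state : a.1.q = C.state
  pos : ∀ i, C.head i ≤ w.length + 1
  sym : ∀ i, a.1.x i = readTape w (C.head i)
  head : a.2.1 = C.head a.1.free
  val : ∀ i, a.1.e i ≠ none → counterVal a.2.2 (a.1.e i) = blockDist w (a.1.dir i) (C.head i)
  near : ∀ i, a.1.e i ≠ none →
    NearInv M w N a.1.x i (a.1.dir i) a.1.q (C.head i) (a.1.near i)

theorem Phase.counter_le {α σ : Type*} {K N : ℕ} {M : MultiHeadAutomaton α (K + 1) σ} {w : List α}
    {a : Conf K (Mem α σ K N)} {C : MultiHeadConfig (K + 1) σ} (h : Phase M w a C) (j : Fin K) :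
    a.2.2 j ≤ w.length := by
  have h1 := h.val (a.1.e.symm (some j)) (by simp)
  have h2 := blockDist_le (a.1.dir (a.1.e.symm (some j))) (h.pos (a.1.e.symm (some j)))
  rw [← h1, a.1.e.apply_symm_apply] at h2
  exact h2

/-! ### Crossing a block end and simulating one step -/

namespace Gadget

universe u v

variable {α : Type u} {σ : Type v} {K N : ℕ} [Finite α] [Finite σ] {w : List α}

/-- Measuring all heads and moving to the free head. -/
noncomputable def settle (good : σ → (Fin (K + 1) → TapeSymbol α) → Fin (K + 1) → Bool) :
    Gadget α K (Mem α σ K N) :=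
  (forEach (measure good) (List.finRange (K + 1))).seq
    (seek (fun s => s.dir s.free) (fun s => s.x s.free))

/-- After all heads have been re-measured for the current state and symbols, the input head can take
the place of the free head, whose block end is known. -/
theorem exec_settle (hw : IsBlockWord w) {M : MultiHeadAutomaton α (K + 1) σ}
    {good : σ → (Fin (K + 1) → TapeSymbol α) → Fin (K + 1) → Bool}
    (hgood : ∀ q x i, M.Drifts N x i (good q x i) q) {s : Mem α σ K N} {h : ℕ} {c : Fin K → ℕ}
    {p : Fin (K + 1) → ℕ} (hs : Stored w s c p) (hh : h ≤ w.length + 1) :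
    ∃ y, (settle good).Exec w (s, h, c) y ∧ Phase M w y ⟨s.q, p⟩ ∧ y.1.ok = s.ok := by
  obtain ⟨⟨s', h', c'⟩, hexec, hJ⟩ := exec_forEach (w := w) (g := measure good)
    (fun D (a : Conf K (Mem α σ K N)) => a.2.1 ≤ w.length + 1 ∧ Stored w a.1 a.2.2 p ∧
      a.1.q = s.q ∧ a.1.x = s.x ∧ a.1.e = s.e ∧ a.1.ok = s.ok ∧
      ∀ i ∈ D, s.e i ≠ none → a.1.dir i = good s.q s.x i ∧
        a.1.near i = cutoff N (blockDist w (!good s.q s.x i) (p i)))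
    (fun D a ha => ha.2.1.counter_le)
    (by
      rintro D ⟨s₁, h₁, c₁⟩ i hi ⟨hle, hst, hq, hx, he, hok, hD⟩
      obtain ⟨s₂, h₂, c₂, hex, hle₂, hst₂, hq₂, hx₂, he₂, hok₂, hi₂, hj₂⟩ :=
        exec_measure hw good hst hle i
      dsimp only at *
      refine ⟨(s₂, h₂, c₂), hex, hle₂, hst₂, hq₂.trans hq, hx₂.trans hx, he₂.trans he,
        hok₂.trans hok, ?_⟩
      intro j hj hn
      by_cases hji : j = i
      · subst hji
        rw [he, hq, hx] at hi₂
        exact hi₂ hn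
      · rcases hj with hj | hj
        · exact absurd hj hji
        · rw [(hj₂ j hji).1, (hj₂ j hji).2]
          exact hD j hj hn)
    (List.finRange (K + 1)) (List.nodup_finRange _) ∅ (by simp) (s, h, c)
    ⟨hh, hs, rfl, rfl, rfl, rfl, by simp⟩
  obtain ⟨hle, hst, hq, hx, he, hok, hD⟩ := hJ
  dsimp only at *
  refine ⟨_, hexec.seq (exec_seek hle hst.counter_le (hst.pos s'.free) (hst.sym s'.free).symm),
    ⟨hq, hst.pos, hst.sym, ?_, fun i _ => hst.val i, ?_⟩, hok⟩
  -- The fictitious counter reads zero, so the free head is at the block end that `seek` finds.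
  · have := hst.val s'.free
    rw [s'.e_free, counterVal, eq_comm, blockDist_eq_zero (hst.pos _), ← hst.sym] at this
    exact this.symm
  · intro i hn
    dsimp only at *
    rw [he] at hn
    obtain ⟨h1, h2⟩ := hD i (by simp) hn
    rw [h1, h2, hq, hx]
    refine ⟨hgood _ _ _, by simp [cutoff], ?_⟩
    -- A distance up to `N` is recorded exactly; otherwise `N` is recorded, which is safe.
    by_cases hN : blockDist w (!good s.q s.x i) (p i) ≤ N
    · left
      simp [cutoff, hN]
    · right
      have : ((cutoff N (blockDist w (!good s.q s.x i) (p i)) : Fin (N + 1)) : ℕ) = N := by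
        simp [cutoff]
        omega
      rw [this]
      exact (hgood _ _ _).safe

/-- The head that is about to leave its block. -/
def _root_.Mem.crossing (s : Mem α σ K N) : Fin (K + 1) := s.ev.getD 0

/-- Carrying out a step in which some head leaves its block. -/
noncomputable def cross (good : σ → (Fin (K + 1) → TapeSymbol α) → Fin (K + 1) → Bool) :
    Gadget α K (Mem α σ K N) :=
  (clear fun s => s.e s.crossing).seq <|
  (walk (fun _ => false) (fun s => s.x s.free) (fun s => s.e s.crossing)).seq <|
  (act fun s _ _ => ({ s with
    dir := Function.update (Function.update s.dir s.free false) s.crossing (s.mv s.crossing).side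
    e := s.e.trans (Equiv.swap none (s.e s.crossing)) }, .stay, fun _ => .keep)).seq <|
  (forEach advance (List.finRange (K + 1))).seq <|
  settle good

/-- The counter of the crossing head is redundant and takes over the free head, so the two exchange
their roles. If the free head itself crosses, the exchange is trivial and only the fictitious
counter is involved. -/
theorem exec_cross (hw : IsBlockWord w) {M : MultiHeadAutomaton α (K + 1) σ}
    {good : σ → (Fin (K + 1) → TapeSymbol α) → Fin (K + 1) → Bool}
    (hgood : ∀ q x i, M.Drifts N x i (good q x i) q) {s : Mem α σ K N} {c : Fin K → ℕ}
    {p : Fin (K + 1) → ℕ} (hpos : ∀ i, p i ≤ w.length + 1) (hsym : ∀ i, s.x i = readTape w (p i))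
    (hval : ∀ i, s.e i ≠ none → counterVal c (s.e i) = blockDist w (s.dir i) (p i))
    (hc : ∀ j, c j ≤ w.length)
    {d : Bool} (hmv : s.mv s.crossing = dirMove d) (hd : blockDist w d (p s.crossing) = 0) :
    ∃ y, (cross good).Exec w (s, p s.free, c) y ∧
      Phase M w y ⟨s.q, fun i => (s.mv i).apply w.length (p i)⟩ ∧ y.1.ok = s.ok := by
  classical
  set j := s.crossing with hj
  have hc₀ : ∀ a, counterSet c (s.e j) 0 a ≤ w.length := counterSet_le hc _ (by omega)
  have hwalk := exec_walk (K := K) hw (d := fun _ : Mem α σ K N => false)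
    (X := fun s : Mem α σ K N => s.x s.free) (a := fun s : Mem α σ K N => s.e s.crossing) (s := s)
    (c := counterSet c (s.e j) 0) (hpos s.free) (hsym s.free).symm hc₀
    (counterVal_counterSet_self _ _ (fun _ => rfl))
  simp only [← hj, counterSet_counterSet] at hwalk
  set c₁ := counterSet c (s.e j) (blockDist w false (p s.free)) with hc₁
  have hc₁le : ∀ a, c₁ a ≤ w.length := counterSet_le hc _ (blockDist_le _ (hpos _))
  -- The update at `j` is the outer one: it must prevail when `j` is the free head.
  let s₁ : Mem α σ K N := { s with
    dir := Function.update (Function.update s.dir s.free false) j (s.mv j).side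
    e := s.e.trans (Equiv.swap none (s.e j)) }
  have he₁ : ∀ i, s₁.e i = Equiv.swap none (s.e j) (s.e i) := fun i => rfl
  have he₁j : s₁.e j = none := by rw [he₁, Equiv.swap_apply_right]
  have hst₁ : Stored w s₁ c₁ p := by
    refine ⟨hpos, hsym, fun i => ?_⟩
    by_cases hij : i = j
    · subst hij
      rw [he₁j]
      simp only [s₁, Function.update_self, hmv, side_dirMove, hd]
      rfl
    · have hne : s.e i ≠ s.e j := fun h => hij (s.e.injective h)
      by_cases hif : i = s.free
      · subst hif
        rw [he₁, s.e_free, Equiv.swap_apply_left]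
        simp only [s₁, Function.update_of_ne hij, Function.update_self]
        rw [hc₁, counterVal_counterSet_self]
        intro hn
        exact absurd (s.e_free.trans hn.symm) hne
      · have hn : s.e i ≠ none := fun hn => hif (by rw [Mem.free, ← hn, Equiv.symm_apply_apply])
        rw [he₁, Equiv.swap_apply_of_ne_of_ne hn hne]
        simp only [s₁, Function.update_of_ne hij, Function.update_of_ne hif]
        rw [hc₁, counterVal_counterSet_of_ne _ hne.symm, hval i hn]
  obtain ⟨⟨s₂, h₂, c₂⟩, hexec, hJ⟩ := exec_forEach (w := w) (g := advance)
    (fun D (a : Conf K (Mem α σ K N)) => a.2.1 ≤ w.length + 1 ∧ Stored w a.1 a.2.2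
      (fun i => if i ∈ D then (s.mv i).apply w.length (p i) else p i) ∧
      a.1.q = s₁.q ∧ a.1.e = s₁.e ∧ a.1.mv = s₁.mv ∧ a.1.ok = s₁.ok)
    (fun D a ha => ha.2.1.counter_le)
    (by
      rintro D ⟨s₂, h₂, c₂⟩ i hi ⟨hle, hst, hq, he, hmv₂, hok⟩
      dsimp only at *
      obtain ⟨s₃, h₃, c₃, hex, hle₃, hst₃, hq₃, he₃, hmv₃, hok₃⟩ := exec_advance hw hst hle i (by
        intro hn
        -- After the exchange the only head without a counter is the crossing one, as `exec_advance`
        -- requires.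
        obtain rfl : i = j := s₁.e.injective (by rw [he₁j, ← he, hn])
        rw [if_neg hi, hmv₂]
        exact ⟨d, hmv, hd⟩)
      refine ⟨(s₃, h₃, c₃), hex, hle₃, ?_, hq₃.trans hq, he₃.trans he, hmv₃.trans hmv₂,
        hok₃.trans hok⟩
      convert hst₃ using 1
      funext l
      by_cases hl : l = i
      · subst hl
        simp [hi, hmv₂, s₁]
      · simp [hl])
    (List.finRange (K + 1)) (List.nodup_finRange _) ∅ (by simp)
    (s₁, blockEnd w false (s.x s.free), c₁)
    ⟨by rw [hsym]; exact (blockEnd_spec false (hpos s.free)).1, by simpa using hst₁, rfl, rfl, rfl, rfl⟩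
  obtain ⟨hle, hst, hq, he, hmv₂, hok⟩ := hJ
  dsimp only at *
  obtain ⟨y, hy, hph, hyok⟩ := exec_settle hw hgood hst hle
  refine ⟨y, (exec_clear hc).seq <| hwalk.seq <| (exec_keep_stay s₁ rfl hc₁le).seq <|
    hexec.seq hy, ?_, hyok.trans hok⟩
  rw [hq] at hph
  simpa using hph

open scoped Classical in
/-- Some head that is stored in a counter and is about to leave its block. -/
noncomputable def leaving (e : Fin (K + 1) ≃ Option (Fin K)) (dir : Fin (K + 1) → Bool)
    (near : Fin (K + 1) → Fin (N + 1)) (mv : Fin (K + 1) → HeadMove) (t : Fin K → Bool) :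
    Option (Fin (K + 1)) :=
  if h : ∃ i, e i ≠ none ∧ ((mv i = dirMove (dir i) ∧ counterZero t (e i) = true) ∨
    (mv i = dirMove (!dir i) ∧ near i = 0)) then some h.choose else none

open scoped Classical in
/-- The counter operation that follows a movement of the head stored in the counter `a`. -/
noncomputable def follow (s : Mem α σ K N) (a : Fin K) : CounterOp :=
  let i := s.e.symm (some a)
  if s.mv i = dirMove (s.dir i) then .dec
  else if s.mv i = dirMove (!s.dir i) then .inc else .keep

open scoped Classical in
/-- The change of the distance from the other side caused by a movement. -/
noncomputable def followNear (s : Mem α σ K N) (i : Fin (K + 1)) : Fin (N + 1) :=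
  if s.mv i = dirMove (s.dir i) then cutoff N (s.near i + 1)
  else if s.mv i = dirMove (!s.dir i) then cutoff N (s.near i - 1) else s.near i

open scoped Classical in
/-- Moving the input head like the free head, unless this leaves the block. -/
noncomputable def tryMove : Gadget α K (Mem α σ K N) :=
  (act fun s _ _ => (s, s.mv s.free, fun _ => .keep)).seq
  (act fun s y _ => if y = s.x s.free then (s, .stay, fun _ => .keep) else
    ({ s with ev := some s.free }, dirMove (!(s.mv s.free).side), fun _ => .keep))

/-- Simulating one step. -/
noncomputable def round (M : MultiHeadAutomaton α (K + 1) σ)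
    (good : σ → (Fin (K + 1) → TapeSymbol α) → Fin (K + 1) → Bool) : Gadget α K (Mem α σ K N) :=
  (act fun s _ t => ({ s with
    q := (M.trans s.q s.x).1
    mv := (M.trans s.q s.x).2
    ev := leaving s.e s.dir s.near (M.trans s.q s.x).2 t }, .stay, fun _ => .keep)).seq <|
  (cond (fun s => s.ev.isNone) tryMove (act fun s _ _ => (s, .stay, fun _ => .keep))).seq <|
  cond (fun s => s.ev.isNone)
    (act fun s _ _ => ({ s with near := followNear s }, .stay, follow s)) (cross good)

/-- No counter measures the free head, so its leaving the block is found by trial: move, compare the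
symbols and, if they differ, move back. -/
theorem exec_tryMove (hw : IsBlockWord w) {s : Mem α σ K N} {c : Fin K → ℕ} {p : ℕ}
    (hp : p ≤ w.length + 1) (hx : s.x s.free = readTape w p) (hc : ∀ a, c a ≤ w.length) :
    (readTape w ((s.mv s.free).apply w.length p) = readTape w p ∧
      tryMove.Exec w (s, p, c) (s, (s.mv s.free).apply w.length p, c)) ∨
    ((∃ d, s.mv s.free = dirMove d ∧ blockDist w d p = 0) ∧
      tryMove.Exec w (s, p, c) ({ s with ev := some s.free }, p, c)) := by
  classical
  by_cases h : readTape w ((s.mv s.free).apply w.length p) = readTape w p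
  · exact .inl ⟨h, (exec_keep s (s.mv s.free) rfl hc).seq
      (exec_keep_stay s (by rw [hx, if_pos h]) hc)⟩
  · right
    obtain ⟨d, hd⟩ : ∃ d, s.mv s.free = dirMove d := by
      rcases hm : s.mv s.free with _ | _ | _
      · exact ⟨false, rfl⟩
      · rw [hm] at h
        exact absurd rfl h
      · exact ⟨true, rfl⟩
    rw [hd] at h
    refine ⟨⟨d, hd, ?_⟩, ?_⟩
    · by_contra hpos
      exact h (hw.readTape_apply hp (Nat.pos_of_ne_zero hpos))
    · refine (exec_keep s (s.mv s.free) rfl hc).seq ?_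
      have := exec_keep (w := w) (K := K) (s := s) (h := (s.mv s.free).apply w.length p) (c := c)
        (f := fun s y _ => if y = s.x s.free then (s, .stay, fun _ => .keep) else
          ({ s with ev := some s.free }, dirMove (!(s.mv s.free).side), fun _ => .keep))
        { s with ev := some s.free } (dirMove (!d))
        (by rw [if_neg (by rw [hx, hd]; exact h), hd, side_dirMove]) hc
      rw [hd, apply_apply_of_ne hp h] at this
      rw [hd]
      exact this

/-- The stored heads are examined before the input head moves, so a crossing always starts with the
input head still at the old position of the free head. -/
theorem exec_round (hw : IsBlockWord w) {M : MultiHeadAutomaton α (K + 1) σ}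
    {good : σ → (Fin (K + 1) → TapeSymbol α) → Fin (K + 1) → Bool}
    (hgood : ∀ q x i, M.Drifts N x i (good q x i) q) {a : Conf K (Mem α σ K N)}
    {C : MultiHeadConfig (K + 1) σ} (ha : Phase M w a C) :
    ∃ b, (round M good).Exec w a b ∧ Phase M w b (M.step w C) ∧ b.1.ok = a.1.ok := by
  classical
  obtain ⟨s, h, c⟩ := a
  obtain ⟨q, p⟩ := C
  obtain ⟨hq, hpos, hsym, hh, hval, hnear⟩ := id ha
  have hc := ha.counter_le
  dsimp only at *
  subst hq hh
  have htr : M.trans s.q (fun i => readTape w (p i)) = M.trans s.q s.x := by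
    congr 1
    funext i
    exact (hsym i).symm
  have hstep : M.step w ⟨s.q, p⟩ = ⟨(M.trans s.q s.x).1,
      fun i => ((M.trans s.q s.x).2 i).apply w.length (p i)⟩ := by
    simp only [MultiHeadAutomaton.step, htr]
  rw [hstep]
  set mv := (M.trans s.q s.x).2 with hmv
  set q' := (M.trans s.q s.x).1 with hq'
  let s₁ : Mem α σ K N := { s with
    q := q'
    mv := mv
    ev := leaving s.e s.dir s.near mv fun i => decide (c i = 0) }
  have hfirst : (act fun (s : Mem α σ K N) (_ : TapeSymbol α) t => ({ s with
    q := (M.trans s.q s.x).1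
    mv := (M.trans s.q s.x).2
    ev := leaving s.e s.dir s.near (M.trans s.q s.x).2 t }, HeadMove.stay,
      fun _ => CounterOp.keep)).Exec w (s, p s.free, c) (s₁, p s.free, c) :=
    exec_keep_stay s₁ rfl hc
  by_cases hex : ∃ i, s.e i ≠ none ∧ ((mv i = dirMove (s.dir i) ∧
      counterZero (fun i => decide (c i = 0)) (s.e i) = true) ∨
      (mv i = dirMove (!s.dir i) ∧ s.near i = 0))
  · have hev : s₁.ev = some hex.choose := by
      simp only [s₁, leaving]
      rw [dif_pos hex]
    obtain ⟨hn, hcase⟩ := hex.choose_spec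
    have hcr : s₁.crossing = hex.choose := by rw [Mem.crossing, hev]; rfl
    obtain ⟨d, hd1, hd2⟩ : ∃ d, s₁.mv s₁.crossing = dirMove d ∧
        blockDist w d (p s₁.crossing) = 0 := by
      rw [hcr]
      rcases hcase with ⟨h1, h2⟩ | ⟨h1, h2⟩
      · refine ⟨_, h1, ?_⟩
        rw [counterZero_eq, decide_eq_true_eq, hval _ hn] at h2
        exact h2
      · refine ⟨_, h1, ?_⟩
        rcases (hnear _ hn).eq_or_safe with h3 | h3
        · rw [← h3, h2]
          rfl
        -- A head that is safe with value `0` makes no move against its drift. So a recorded `0`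
        -- together with such a move means that the recorded distance is exact.
        · have := h3.nonneg
          rw [← hmv, h1, signTo_dirMove_not, h2] at this
          simp at this
    obtain ⟨b, hb, hph, hok⟩ := exec_cross (s := s₁) hw hgood hpos hsym hval hc hd1 hd2
    exact ⟨b, hfirst.seq <| (Exec.cond_false (by simp [hev]) (exec_skip hc)).seq <|
      Exec.cond_false (by simp [hev]) hb, hph, hok⟩
  · have hev : s₁.ev = none := by
      simp only [s₁, leaving]
      rw [dif_neg hex]
    rcases exec_tryMove (s := s₁) hw (hpos s.free) (hsym s.free) hc with
      ⟨hread, hmove⟩ | ⟨⟨d, hd1, hd2⟩, hmove⟩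
    -- No stored head leaves its block, so all of them can be followed by one operation on each
    -- counter.
    · have hspec : ∀ i, s.e i ≠ none → _ := fun i hn =>
        NearInv.follow hw (hpos i) (hnear i hn) (m := mv i) rfl
        (fun hx => hex ⟨i, hn, .inl ⟨hx.1, by
          rw [counterZero_eq, decide_eq_true_eq, hval i hn]; exact hx.2⟩⟩)
        (fun hx => hex ⟨i, hn, .inr hx⟩)
      have hp' : ∀ i, (mv i).apply w.length (p i) ≤ w.length + 1 := fun i => apply_le _ (hpos i)
      let c' : Fin K → ℕ := fun a => (follow s₁ a).apply (c a)
      have hval' : ∀ i, s.e i ≠ none →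
          counterVal c' (s.e i) = blockDist w (s.dir i) ((mv i).apply w.length (p i)) := by
        intro i hn
        obtain ⟨-, h1, h2, h3⟩ := hspec i hn
        have hv := hval i hn
        obtain ⟨b, hb⟩ := Option.ne_none_iff_exists'.1 hn
        have hb' : s.e.symm (some b) = i := by rw [← hb, Equiv.symm_apply_apply]
        rw [hb] at hv ⊢
        simp only [counterVal, c', follow] at hv ⊢
        simp only [s₁, hb']
        rcases eq_dirMove_or (mv i) (s.dir i) with hm | hm | hm
        · rw [if_pos hm, (h1 hm).1, hv, CounterOp.apply]
        · rw [if_neg (by rw [hm]; exact dirMove_not_ne _), if_pos hm, (h2 hm).1, hv,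
            CounterOp.apply]
        · rw [if_neg (by rw [hm]; exact stay_ne_dirMove _),
            if_neg (by rw [hm]; exact stay_ne_dirMove _), hm, CounterOp.apply, hv]
          rfl
      have hc' : ∀ a, c' a ≤ w.length := by
        intro a
        have h1 := hval' (s.e.symm (some a)) (by simp)
        rw [Equiv.apply_symm_apply] at h1
        have h2 := blockDist_le (s.dir (s.e.symm (some a))) (hp' (s.e.symm (some a)))
        rw [← h1] at h2
        exact h2
      let s₂ : Mem α σ K N := { s₁ with near := followNear s₁ }
      have hlast : (act fun (s : Mem α σ K N) (_ : TapeSymbol α) _ =>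
          ({ s with near := followNear s }, HeadMove.stay, follow s)).Exec w
          (s₁, (mv s.free).apply w.length (p s.free), c)
          (s₂, (mv s.free).apply w.length (p s.free), c') :=
        exec_act (m := .stay) rfl (fun _ => rfl) hc'
      refine ⟨_, hfirst.seq <| (Exec.cond_true (by simp [hev]) hmove).seq <|
        Exec.cond_true (by simp [hev]) hlast, ⟨rfl, hp', ?_, rfl, hval', ?_⟩, rfl⟩
      · intro i
        by_cases hn : s.e i = none
        · have hif : i = s.free := by rw [Mem.free, ← hn, Equiv.symm_apply_apply]
          rw [hif]
          exact (hsym s.free).trans hread.symm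
        · exact (hsym i).trans (hspec i hn).1.symm
      · intro i hn
        obtain ⟨-, h1, h2, h3⟩ := hspec i hn
        simp only [s₂, followNear]
        simp only [s₁]
        rcases eq_dirMove_or (mv i) (s.dir i) with hm | hm | hm
        · rw [if_pos hm]
          exact (h1 hm).2
        · rw [if_neg (by rw [hm]; exact dirMove_not_ne _), if_pos hm]
          exact (h2 hm).2
        · rw [if_neg (by rw [hm]; exact stay_ne_dirMove _),
            if_neg (by rw [hm]; exact stay_ne_dirMove _)]
          exact h3 hm
    · obtain ⟨b, hb, hph, hok⟩ := exec_cross (s := { s₁ with ev := some s₁.free }) hw hgood hpos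
        hsym hval hc hd1 hd2
      exact ⟨b, hfirst.seq <| (Exec.cond_true (by simp [hev]) hmove).seq <|
        Exec.cond_false (by simp) hb, hph, hok⟩

end Gadget

/-! ### Checking the input -/

/-- The block condition for the positions before `p`. -/
def BlockBefore {α : Type*} (w : List α) (p : ℕ) : Prop :=
  ∀ a b c, a ≤ b → b ≤ c → c < p → readTape w a = readTape w c → readTape w b = readTape w a

/-- A one-pass test: a new symbol must continue the current block or be entirely new. It needs only
the last symbol and the set of symbols seen. -/
theorem blockBefore_succ {α : Type*} {w : List α} {p : ℕ} :
    BlockBefore w (p + 2) ↔ BlockBefore w (p + 1) ∧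
      (readTape w (p + 1) = readTape w p ∨ ∀ a, a < p + 1 → readTape w a ≠ readTape w (p + 1)) := by
  constructor
  · intro h
    refine ⟨fun a b c hab hbc hc => h a b c hab hbc (by omega), ?_⟩
    by_contra! hcon
    obtain ⟨h1, a, ha, h2⟩ := hcon
    have := h a p (p + 1) (by omega) (by omega) (by omega) h2
    exact h1 (by rw [this, h2])
  · rintro ⟨h, h'⟩ a b c hab hbc hc hac
    by_cases hcp : c < p + 1
    · exact h a b c hab hbc hcp hac
    obtain rfl : c = p + 1 := by omega
    by_cases hb : b = p + 1
    · rw [hb, hac]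
    rcases h' with h' | h'
    · exact h a b p hab (by omega) (by omega) (hac.trans h')
    · exact absurd hac (h' a (by omega))

/-- The right end-marker occurs once and cannot violate the condition, so the sweep may stop in
front of it. -/
theorem blockBefore_iff {α : Type*} {w : List α} :
    BlockBefore w (w.length + 1) ↔ IsBlockWord w := by
  constructor
  · intro h a b c hab hbc hc hac
    by_cases hc' : c < w.length + 1
    · exact h a b c hab hbc hc' hac
    · have h1 := (readTape_eq_rightEnd w (p := c)).2 (by omega)
      rw [h1, readTape_eq_rightEnd] at hac
      obtain rfl : b = a := by omega
      rfl
  · intro h a b c hab hbc hc hac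
    exact h a b c hab hbc (by omega) hac

namespace Gadget

universe u v

variable {α : Type u} {σ : Type v} {K N : ℕ} [Finite α] [Finite σ] {w : List α}

open scoped Classical in
/-- Checking that every symbol occupies an interval of the tape. -/
noncomputable def sweep : Gadget α K (Mem α σ K N) :=
  loop (fun _ y _ => !y.isRight)
    (act fun s y _ => ({ s with
      ok := s.ok && decide (y = s.last ∨ y ∉ s.seen)
      seen := insert y s.seen
      last := y }, .right, fun _ => .keep))

/-- What the check has found out before position `p + 1`. -/
structure Swept (w : List α) (p : ℕ) (s s' : Mem α σ K N) : Prop where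
  ok : s'.ok = true ↔ BlockBefore w (p + 1)
  seen : ∀ y, y ∈ s'.seen ↔ ∃ a, a < p + 1 ∧ readTape w a = y
  last : s'.last = readTape w p
  q : s'.q = s.q
  e : s'.e = s.e
  dir : s'.dir = s.dir

theorem exec_sweep {s : Mem α σ K N} {c : Fin K → ℕ} (hc : ∀ a, c a ≤ w.length) (m : ℕ) :
    ∀ p s', p + m = w.length → Swept w p s s' → ∃ s'', sweep.Exec w (s', p + 1, c)
      (s'', w.length + 1, c) ∧ Swept w w.length s s'' := by
  classical
  induction m with
  | zero =>
    intro p s' hp hs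
    obtain rfl : p = w.length := by omega
    exact ⟨s', exec_loop_false hc (by simp [CounterMachine.readTape_isRight]), hs⟩
  | succ m ih =>
    intro p s' hp hs
    obtain ⟨s'', h1, h2⟩ := ih (p + 1) { s' with
      ok := s'.ok && decide (readTape w (p + 1) = s'.last ∨ readTape w (p + 1) ∉ s'.seen)
      seen := insert (readTape w (p + 1)) s'.seen
      last := readTape w (p + 1) } (by omega) (by
        refine ⟨?_, ?_, rfl, hs.q, hs.e, hs.dir⟩
        · rw [blockBefore_succ, ← hs.ok, ← hs.last, Bool.and_eq_true, decide_eq_true_eq, hs.seen]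
          simp only [not_exists, not_and, ne_eq]
        · intro y
          simp only [Set.mem_insert_iff, hs.seen]
          constructor
          · rintro (rfl | ⟨a, ha, rfl⟩)
            · exact ⟨p + 1, by omega, rfl⟩
            · exact ⟨a, by omega, rfl⟩
          · rintro ⟨a, ha, rfl⟩
            by_cases hap : a = p + 1
            · exact .inl (by rw [hap])
            · exact .inr ⟨a, by omega, rfl⟩)
    refine ⟨s'', exec_loop_true hc ?_ (exec_keep _ .right rfl hc) ?_, h2⟩
    · simp [CounterMachine.readTape_isRight]
      omega
    · have : HeadMove.right.apply w.length (p + 1) = p + 1 + 1 := by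
        simp only [HeadMove.apply]
        omega
      rw [this]
      exact h1

/-- The initial memory. -/
def _root_.Mem.init (q : σ) : Mem α σ K N where
  q := q
  x _ := .leftEnd
  e := finSuccEquiv K
  dir _ := false
  near _ := 0
  mv _ := .stay
  t := 0
  ev := none
  ok := true
  seen := {.leftEnd}
  last := .leftEnd

/-- Checking the input and preparing the simulation. -/
noncomputable def prepare (good : σ → (Fin (K + 1) → TapeSymbol α) → Fin (K + 1) → Bool) :
    Gadget α K (Mem α σ K N) :=
  sweep.seq <| (seek (fun _ => false) (fun _ => .leftEnd)).seq <|
  (act fun s _ _ => (s, .right, fun _ => .keep)).seq <|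
  (act fun s y _ => ({ s with x := fun _ => y }, .stay, fun _ => .keep)).seq <|
  cond (fun s => s.ok) (settle good) (act fun s _ _ => (s, .stay, fun _ => .keep))

theorem exec_prepare {M : MultiHeadAutomaton α (K + 1) σ}
    {good : σ → (Fin (K + 1) → TapeSymbol α) → Fin (K + 1) → Bool}
    (hgood : ∀ q x i, M.Drifts N x i (good q x i) q) :
    ∃ a : Conf K (Mem α σ K N), (prepare good).Exec w (Mem.init M.start, 1, fun _ => 0) a ∧
      (∀ i, a.2.2 i ≤ w.length) ∧
      (a.1.ok = true ↔ IsBlockWord w) ∧ (IsBlockWord w → Phase M w a M.init) := by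
  have hc : ∀ i : Fin K, (fun _ => 0 : Fin K → ℕ) i ≤ w.length := fun _ => Nat.zero_le _
  have h0 : ∀ a, a < 0 + 1 → a = 0 := by omega
  obtain ⟨s, hexec, hs⟩ := exec_sweep (s := (Mem.init M.start : Mem α σ K N)) hc w.length 0
    (Mem.init M.start) (by omega) (by
      refine ⟨?_, ?_, rfl, rfl, rfl, rfl⟩
      · simp only [Mem.init, true_iff]
        intro a b c hab hbc hc _
        obtain rfl : b = a := by omega
        rfl
      · intro y
        simp only [Mem.init, Set.mem_singleton_iff]
        constructor
        · rintro rfl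
          exact ⟨0, by omega, rfl⟩
        · rintro ⟨a, ha, rfl⟩
          rw [h0 a ha, readTape_zero])
  have hE : blockEnd w false (.leftEnd : TapeSymbol α) = 0 := by
    have h := blockEnd_le (w := w) (p := 0) (by omega)
    rw [readTape_zero] at h
    omega
  have hseek := exec_seek (K := K) (w := w) (d := fun _ : Mem α σ K N => false)
    (X := fun _ => .leftEnd) (s := s) (h := w.length + 1) (p := 0) le_rfl hc (by omega)
    (readTape_zero w)
  simp only [hE] at hseek
  have hright : HeadMove.right.apply w.length 0 = 1 := by simp [HeadMove.apply]
  have hmove := exec_keep (K := K) (w := w) (h := 0)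
    (f := fun (s : Mem α σ K N) _ _ => (s, .right, fun _ => .keep)) (s := s) s .right rfl hc
  rw [hright] at hmove
  let s₁ : Mem α σ K N := { s with x := fun _ => readTape w 1 }
  have hset := exec_keep_stay (K := K) (w := w) (h := 1) (s := s)
    (f := fun (s : Mem α σ K N) y _ => ({ s with x := fun _ => y }, .stay, fun _ => .keep))
    s₁ rfl hc
  have hpre := fun a h => hexec.seq <| hseek.seq <| hmove.seq <| hset.seq (c := a)
      (H := cond (fun s => s.ok) (settle good) (act fun s _ _ => (s, .stay, fun _ => .keep))) h
  have hok : s.ok = true ↔ IsBlockWord w := by rw [hs.ok, blockBefore_iff]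
  by_cases hw : IsBlockWord w
  -- Position `1` is the left end of its block, since the left end-marker occurs only at `0`. With
  -- all sides set to the left, zero counters therefore store the initial positions.
  · have hst : Stored w s₁ (fun _ => 0) (fun _ => 1) := by
      refine ⟨fun _ => by omega, fun _ => rfl, fun i => ?_⟩
      have h1 : counterVal (fun _ => 0 : Fin K → ℕ) (s₁.e i) = 0 := by
        cases s₁.e i <;> rfl
      have h2 : s₁.dir i = false := by
        change s.dir i = false
        rw [hs.dir]
        rfl
      rw [h1, h2, eq_comm, blockDist_eq_zero (by omega)]
      have h3 := blockEnd_spec (w := w) (p := 1) false (by omega)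
      have h4 := blockEnd_le (w := w) (p := 1) (by omega)
      by_contra hne
      have h5 : blockEnd w false (readTape w 1) = 0 := by omega
      have h6 := h3.2
      rw [h5, readTape_zero, eq_comm, readTape_eq_leftEnd] at h6
      omega
    obtain ⟨a, ha, hph, haok⟩ := exec_settle (h := 1) hw hgood hst (by omega)
    have hq : s₁.q = M.start := hs.q
    rw [hq] at hph
    refine ⟨a, hpre a (Exec.cond_true (hok.2 hw) ha), hph.counter_le, ?_, fun _ => hph⟩
    rw [haok]
    exact hok
  · refine ⟨_, hpre _ (Exec.cond_false ?_ (exec_skip hc)), hc, hok, fun h => absurd h hw⟩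
    rw [← hok] at hw
    simpa using hw

end Gadget

/-! ### Strictly bounded languages -/

open scoped Computability in
theorem mem_of_mem_prod {α : Type*} {l : List α} {w : List α}
    (hw : w ∈ (l.map fun a => ({[a]} : Language α)∗).prod) : ∀ b ∈ w, b ∈ l := by
  induction l generalizing w with
  | nil =>
    simp only [List.map_nil, List.prod_nil, Language.mem_one] at hw
    simp [hw]
  | cons a l ih =>
    rw [List.map_cons, List.prod_cons, Language.mem_mul] at hw
    obtain ⟨u, hu, v, hv, rfl⟩ := hw
    obtain ⟨L, rfl, hL⟩ := Language.mem_kstar.1 hu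
    intro b hb
    rcases List.mem_append.1 hb with hb | hb
    · obtain ⟨y, hy, hby⟩ := List.mem_flatten.1 hb
      have : y = [a] := hL y hy
      simp_all
    · exact List.mem_cons_of_mem _ (ih hv b hb)

-- Induction on the factors. If position `i` lies in the first factor and `m` behind it, the first
-- symbol would recur among the later ones, contrary to distinctness.
open scoped Computability in
theorem getElem?_of_mem_prod {α : Type*} {l : List α} (hl : l.Nodup) {w : List α}
    (hw : w ∈ (l.map fun a => ({[a]} : Language α)∗).prod) {i j m : ℕ} (hij : i ≤ j) (hjm : j ≤ m)
    (hm : m < w.length) (h : w[i]? = w[m]?) : w[j]? = w[i]? := by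
  induction l generalizing w i j m with
  | nil =>
    simp only [List.map_nil, List.prod_nil, Language.mem_one] at hw
    simp [hw] at hm
  | cons a l ih =>
    rw [List.nodup_cons] at hl
    rw [List.map_cons, List.prod_cons, Language.mem_mul] at hw
    obtain ⟨u, hu, v, hv, rfl⟩ := hw
    have hu' : ∀ r, r < u.length → u[r]? = some a := by
      obtain ⟨L, rfl, hL⟩ := Language.mem_kstar.1 hu
      intro r hr
      have hall : ∀ b ∈ L.flatten, b = a := by
        intro b hb
        obtain ⟨y, hy, hby⟩ := List.mem_flatten.1 hb
        have : y = [a] := hL y hy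
        simp_all
      rw [List.getElem?_eq_getElem hr, hall _ (List.getElem_mem hr)]
    by_cases hmu : m < u.length
    · rw [List.getElem?_append_left (by omega), List.getElem?_append_left (by omega),
        hu' j (by omega), hu' i (by omega)]
    · rw [List.getElem?_append_right (l₁ := u) (i := m) (by omega)] at h
      rw [List.length_append] at hm
      by_cases hiu : i < u.length
      · rw [List.getElem?_append_left hiu, hu' i hiu, eq_comm] at h
        exact absurd (mem_of_mem_prod hv a (List.mem_of_getElem? h)) hl.1
      · rw [List.getElem?_append_right (by omega)] at h ⊢
        rw [List.getElem?_append_right (by omega)]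
        exact ih hl.2 hv (by omega) (by omega) (by omega) h

theorem StrictlyBounded.isBlockWord {α : Type*} {L : Language α} (hL : StrictlyBounded L)
    {w : List α} (hw : w ∈ L) : IsBlockWord w := by
  obtain ⟨l, hl, hle⟩ := hL
  have key : ∀ r s, readTape w (r + 1) = readTape w (s + 1) ↔ w[r]? = w[s]? := by
    intro r s
    simp only [readTape]
    cases w[r]? <;> cases w[s]? <;> simp
  rw [← blockBefore_iff]
  intro a b c hab hbc hc hac
  rcases a with _ | a
  · rw [readTape_zero, eq_comm, readTape_eq_leftEnd] at hac
    obtain rfl : b = 0 := by omega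
    rfl
  · obtain ⟨b, rfl⟩ : ∃ b', b = b' + 1 := ⟨b - 1, by omega⟩
    obtain ⟨c, rfl⟩ : ∃ c', c = c' + 1 := ⟨c - 1, by omega⟩
    rw [key] at hac ⊢
    exact getElem?_of_mem_prod hl (hle hw) (by omega) (by omega) (by omega) hac

/-! ### The theorem -/

theorem AcceptedByHeads.acceptedByCounters {α : Type*} [Finite α] {K : ℕ} {L : Language α}
    (h : AcceptedByHeads (K + 1) L) (hL : StrictlyBounded L) (pol : OverflowPolicy) :
    AcceptedByCounters pol K L := by
  classical
  obtain ⟨σ, hσ, M, rfl⟩ := h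
  obtain ⟨N, hN⟩ := M.exists_drifts
  choose good hgood using hN
  -- The loop is left only if the check succeeded and the simulated state is final.
  let b : Mem α σ K N → Bool := fun s => !(s.ok && decide (s.q ∈ M.final))
  let G : Gadget α K (Mem α σ K N) :=
    .cond (fun s => s.ok) (.round M good) (.act fun s _ _ => (s, .stay, fun _ => .keep))
  let P : Gadget α K (Mem α σ K N) :=
    (Gadget.prepare good).seq (.loop (fun s _ _ => b s) G)
  have key : ∀ w, (∀ t, ¬ (P.toMachine (Mem.init M.start)).Overflows w
      ((P.toMachine (Mem.init M.start)).run pol w t)) ∧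
      (w ∈ (P.toMachine (Mem.init M.start)).accepts pol ↔ w ∈ M.accepts) := by
    intro w
    obtain ⟨a, ha, hle, hok, hph⟩ := Gadget.exec_prepare (w := w) hgood
    by_cases hw : IsBlockWord w
    · exact Gadget.main_loop (G₀ := Gadget.prepare good) (G := G) (b := b) (M.step w)
        (fun C => C.state ∈ M.final)
        (fun x C => x.1.ok = true ∧ Phase M w x C) ha ⟨hok.2 hw, hph hw⟩
        (fun x C hx => hx.2.counter_le)
        (fun x C hx => by simp [b, hx.1, hx.2.state])
        (fun x C hx _ => by
          obtain ⟨y, hy, hy', hyok⟩ := Gadget.exec_round hw hgood hx.2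
          exact ⟨y, Gadget.Exec.cond_true hx.1 hy, hyok.trans hx.1, hy'⟩) pol
    -- On a rejected input every round does nothing, which is modelled as a trivial system that
    -- never accepts.
    · have hno : a.1.ok = false := by
        rw [← hok] at hw
        simpa using hw
      obtain ⟨h1, h2⟩ := Gadget.main_loop (G₀ := Gadget.prepare good) (G := G) (b := b)
        (id : Unit → Unit) (fun _ => False)
        (fun x _ => x.1.ok = false ∧ ∀ i, x.2.2 i ≤ w.length) (d₀ := ()) ha ⟨hno, hle⟩
        (fun x _ hx => hx.2)
        (fun x _ hx => by simp [b, hx.1])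
        (fun x _ hx _ => ⟨x, Gadget.Exec.cond_false hx.1 (Gadget.exec_skip hx.2), hx⟩) pol
      refine ⟨h1, h2.trans ⟨fun ⟨_, h⟩ => h.elim, fun h => absurd (hL.isBlockWord h) hw⟩⟩
  have hfin := P.finite_control
  exact .of_finite (P.toMachine (Mem.init M.start)) (fun _ w t => (key w).1 t)
    (Set.ext fun w => (key w).2)

theorem mainTheorem1 {α : Type*} [Finite α] (k : ℕ) (hk : 1 ≤ k) (pol : OverflowPolicy)
    (L : Language α) (hL : StrictlyBounded L) :
    AcceptedByHeads k L ↔ AcceptedByCounters pol (k - 1) L := by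
  obtain ⟨K, rfl⟩ : ∃ K, k = K + 1 := ⟨k - 1, by omega⟩
  exact ⟨fun h => h.acceptedByCounters hL pol, fun h => h.acceptedByHeads⟩
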